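/- Let $n_+,n_-\ge 1$ be integers, $n=n_++n_-$, and let $G$ be the star graph with $n$ edges $I_j=(0,1)$, all joined at the endpoint $0$. Let $L^2(G)=\bigoplus_{j=1}^n L^2((0,1))$ (complex-valued functions), and let $B=B_{n_+,n_-}$ be the indefinite Kirchhoff Laplacian in $L^2(G)$, $$(Bf)_j=-f_j''\quad(1\le j\le n_+),\qquad (Bf)_j=f_j''\quad(n_++1\le j\le n),$$ with domain consisting of all $f=(f_1,\dots,f_n)$ such that $f_j\in H^2((0,1))$ and $f_j(1)=0$ for all $j$, $f_1(0)=\dots=f_n(0)$, and $\sum_{j=1}^n f_j'(0)=0$. Then $B$ has a smallest positive eigenvalue $\eta_1$, and $$\frac{n_+}{n_-}=-\coth(\sqrt{\eta_1})\,\tan(\sqrt{\eta_1}).$$ Moreover, the spectrum of $B$ determines the ratio $n_+/n_-$: if $m_+,m_-\ge 1$ are integers and the operators $B_{n_+,n_-}$ and $B_{m_+,m_-}$ have the same spectrum, then $n_+/n_-=m_+/m_-$. -/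

import Mathlib

open MeasureTheory Set

noncomputable section

namespace StarGraph

/-- Lebesgue measure on the open unit interval. -/
abbrev μI : Measure ℝ := volume.restrict (Ioo (0 : ℝ) 1)

/-- The complex Hilbert space `L²((0,1))`. -/
abbrev L2I : Type := Lp ℂ 2 μI

/-- The Hilbert space `L²(G) = ⨁ L²((0,1))` of the star graph with `n` edges of unit length;
the central vertex sits at `0` on each edge and the outer vertices at `1`. -/
abbrev L2G (n : ℕ) : Type := PiLp 2 (fun _ : Fin n => L2I)

/-- `g` is the weak derivative of `f` on `(0,1)`; both are elements of `L²((0,1))`. -/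
def HasWeakDeriv (f g : L2I) : Prop :=
  ∀ φ : ℝ → ℝ, ContDiff ℝ (⊤ : ℕ∞) φ → HasCompactSupport φ → tsupport φ ⊆ Ioo (0 : ℝ) 1 →
    ∫ x in Ioo (0 : ℝ) 1, deriv φ x • f x = - ∫ x in Ioo (0 : ℝ) 1, φ x • g x

lemma integrable_test (f : L2I) {φ : ℝ → ℝ} (hφ : Continuous φ) (hc : HasCompactSupport φ) :
    Integrable (fun x => φ x • f x) μI := by
  have hf : Integrable f μI := (Lp.memLp f).integrable (by norm_num)
  obtain ⟨C, hC⟩ := hc.exists_bound_of_continuous hφ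
  exact hf.bdd_smul C hφ.aestronglyMeasurable (Filter.Eventually.of_forall hC)

lemma HasWeakDeriv.add {f g f' g' : L2I} (hf : HasWeakDeriv f f') (hg : HasWeakDeriv g g') :
    HasWeakDeriv (f + g) (f' + g') := by
  intro φ h1 h2 h3
  have hd : Continuous (deriv φ) := h1.continuous_deriv (by simp)
  have e1 : ∫ x in Ioo (0 : ℝ) 1, deriv φ x • (f + g : L2I) x
      = ∫ x in Ioo (0 : ℝ) 1, (deriv φ x • f x + deriv φ x • g x) := by
    refine integral_congr_ae ?_
    filter_upwards [Lp.coeFn_add f g] with x hx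
    rw [hx, Pi.add_apply, smul_add]
  have e2 : ∫ x in Ioo (0 : ℝ) 1, φ x • (f' + g' : L2I) x
      = ∫ x in Ioo (0 : ℝ) 1, (φ x • f' x + φ x • g' x) := by
    refine integral_congr_ae ?_
    filter_upwards [Lp.coeFn_add f' g'] with x hx
    rw [hx, Pi.add_apply, smul_add]
  rw [e1, e2, integral_add (integrable_test f hd h2.deriv) (integrable_test g hd h2.deriv),
    integral_add (integrable_test f' h1.continuous h2) (integrable_test g' h1.continuous h2),
    hf φ h1 h2 h3, hg φ h1 h2 h3]
  ring

lemma HasWeakDeriv.smul {f f' : L2I} (c : ℂ) (hf : HasWeakDeriv f f') :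
    HasWeakDeriv (c • f) (c • f') := by
  intro φ h1 h2 h3
  have e1 : ∫ x in Ioo (0 : ℝ) 1, deriv φ x • (c • f : L2I) x
      = ∫ x in Ioo (0 : ℝ) 1, c • (deriv φ x • f x) := by
    refine integral_congr_ae ?_
    filter_upwards [Lp.coeFn_smul c f] with x hx
    rw [hx, Pi.smul_apply, smul_comm]
  have e2 : ∫ x in Ioo (0 : ℝ) 1, φ x • (c • f' : L2I) x
      = ∫ x in Ioo (0 : ℝ) 1, c • (φ x • f' x) := by
    refine integral_congr_ae ?_
    filter_upwards [Lp.coeFn_smul c f'] with x hx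
    rw [hx, Pi.smul_apply, smul_comm]
  rw [e1, e2, integral_smul, integral_smul, hf φ h1 h2 h3, smul_neg]

lemma HasWeakDeriv.zero : HasWeakDeriv 0 0 := by
  have h : HasWeakDeriv ((0 : ℂ) • (0 : L2I)) ((0 : ℂ) • (0 : L2I)) := by
    intro φ h1 h2 h3
    have e : ((((0 : ℂ) • (0 : L2I)) : L2I) : ℝ → ℂ) =ᵐ[μI] 0 := by
      rw [smul_zero]; exact Lp.coeFn_zero ℂ 2 μI
    have e1 : ∫ x in Ioo (0 : ℝ) 1, deriv φ x • ((0 : ℂ) • (0 : L2I) : L2I) x = 0 := by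
      refine integral_eq_zero_of_ae ?_
      filter_upwards [e] with x hx
      rw [hx]; simp
    have e2 : ∫ x in Ioo (0 : ℝ) 1, φ x • ((0 : ℂ) • (0 : L2I) : L2I) x = 0 := by
      refine integral_eq_zero_of_ae ?_
      filter_upwards [e] with x hx
      rw [hx]; simp
    rw [e1, e2, neg_zero]
  simpa using h

/-- Weak derivatives are unique. -/
lemma HasWeakDeriv.unique {f g h : L2I} (hg : HasWeakDeriv f g) (hh : HasWeakDeriv f h) :
    g = h := by
  have hgi : Integrable g μI := (Lp.memLp g).integrable (by norm_num)
  have hhi : Integrable h μI := (Lp.memLp h).integrable (by norm_num)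
  have key : ∀ᵐ x ∂(volume : Measure ℝ), x ∈ Ioo (0 : ℝ) 1 → g x - h x = 0 := by
    refine IsOpen.ae_eq_zero_of_integral_contDiff_smul_eq_zero isOpen_Ioo
      (IntegrableOn.locallyIntegrableOn (hgi.sub hhi)) ?_
    intro φ h1 h2 h3
    have hz : ∀ x, x ∉ Ioo (0 : ℝ) 1 → φ x • (g x - h x) = 0 := by
      intro x hx
      have : φ x = 0 := image_eq_zero_of_notMem_tsupport (fun hx' => hx (h3 hx'))
      rw [this, zero_smul]
    change ∫ x, φ x • (g x - h x) = 0
    rw [← setIntegral_eq_integral_of_forall_compl_eq_zero hz]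
    have e := (hg φ h1 h2 h3).symm.trans (hh φ h1 h2 h3)
    simp only [smul_sub]
    rw [integral_sub (integrable_test g h1.continuous h2) (integrable_test h h1.continuous h2),
      neg_injective e, sub_self]
  refine Lp.ext ?_
  rw [Filter.EventuallyEq, ae_restrict_iff' measurableSet_Ioo]
  filter_upwards [key] with x hx hx'
  exact sub_eq_zero.mp (hx hx')

/-- The Sobolev space `H¹((0,1))`. -/
def H1 : Set L2I := {f | ∃ g, HasWeakDeriv f g}

open Classical in
/-- The weak derivative of `f ∈ H¹((0,1))` (set to `0` outside `H¹((0,1))`). -/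
def weakDeriv (f : L2I) : L2I := if h : f ∈ H1 then h.choose else 0

lemma hasWeakDeriv_weakDeriv {f : L2I} (h : f ∈ H1) : HasWeakDeriv f (weakDeriv f) := by
  rw [weakDeriv, dif_pos h]; exact h.choose_spec

lemma HasWeakDeriv.weakDeriv_eq {f g : L2I} (h : HasWeakDeriv f g) : weakDeriv f = g :=
  (hasWeakDeriv_weakDeriv ⟨g, h⟩).unique h

/-- The Sobolev space `H²((0,1))`. -/
def H2 : Set L2I := {f | f ∈ H1 ∧ weakDeriv f ∈ H1}

lemma weakDeriv_zero : weakDeriv 0 = 0 := HasWeakDeriv.zero.weakDeriv_eq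

lemma weakDeriv_add {f g : L2I} (hf : f ∈ H1) (hg : g ∈ H1) :
    weakDeriv (f + g) = weakDeriv f + weakDeriv g :=
  ((hasWeakDeriv_weakDeriv hf).add (hasWeakDeriv_weakDeriv hg)).weakDeriv_eq

lemma weakDeriv_smul {f : L2I} (c : ℂ) (hf : f ∈ H1) :
    weakDeriv (c • f) = c • weakDeriv f :=
  ((hasWeakDeriv_weakDeriv hf).smul c).weakDeriv_eq

lemma H1_zero : (0 : L2I) ∈ H1 := ⟨0, HasWeakDeriv.zero⟩

lemma H1_add {f g : L2I} (hf : f ∈ H1) (hg : g ∈ H1) : f + g ∈ H1 :=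
  ⟨_, (hasWeakDeriv_weakDeriv hf).add (hasWeakDeriv_weakDeriv hg)⟩

lemma H1_smul {f : L2I} (c : ℂ) (hf : f ∈ H1) : c • f ∈ H1 :=
  ⟨_, (hasWeakDeriv_weakDeriv hf).smul c⟩

/-- The class `f` has a representative that is continuous on `[0,1]`, and this (unique)
continuous representative takes the value `c` at `a ∈ [0,1]`. -/
def HasValueAt (f : L2I) (a : ℝ) (c : ℂ) : Prop :=
  ∃ u : ℝ → ℂ, ContinuousOn u (Icc 0 1) ∧ f =ᵐ[μI] u ∧ u a = c

lemma HasValueAt.zero (a : ℝ) : HasValueAt 0 a 0 :=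
  ⟨0, continuousOn_const, Lp.coeFn_zero ℂ 2 μI, rfl⟩

lemma HasValueAt.add {f g : L2I} {a : ℝ} {c d : ℂ} (hf : HasValueAt f a c)
    (hg : HasValueAt g a d) : HasValueAt (f + g) a (c + d) := by
  obtain ⟨u, hu, hfu, rfl⟩ := hf
  obtain ⟨v, hv, hgv, rfl⟩ := hg
  exact ⟨u + v, hu.add hv, (Lp.coeFn_add f g).trans (hfu.add hgv), rfl⟩

lemma HasValueAt.smul {f : L2I} {a : ℝ} {c : ℂ} (b : ℂ) (hf : HasValueAt f a c) :
    HasValueAt (b • f) a (b * c) := by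
  obtain ⟨u, hu, hfu, rfl⟩ := hf
  exact ⟨b • u, hu.const_smul b, (Lp.coeFn_smul b f).trans (hfu.const_smul b), rfl⟩

/-- The domain of the indefinite Kirchhoff Laplacian on the star graph with `n` edges: every
component is in `H²((0,1))`, Dirichlet conditions at the outer vertices, continuity at the
central vertex, and the outgoing derivatives at the central vertex sum to `0`. -/
def kirchhoffDomain (n : ℕ) : Submodule ℂ (L2G n) where
  carrier := {f | (∀ j, f j ∈ H2) ∧ (∀ j, HasValueAt (f j) 1 0) ∧
    (∃ c : ℂ, ∀ j, HasValueAt (f j) 0 c) ∧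
    (∃ d : Fin n → ℂ, (∀ j, HasValueAt (weakDeriv (f j)) 0 (d j)) ∧ ∑ j, d j = 0)}
  zero_mem' := by
    refine ⟨fun j => ⟨H1_zero, ?_⟩, fun j => HasValueAt.zero 1, ⟨0, fun j => HasValueAt.zero 0⟩,
      0, fun j => ?_, by simp⟩
    · change weakDeriv 0 ∈ H1
      rw [weakDeriv_zero]; exact H1_zero
    · change HasValueAt (weakDeriv 0) 0 0
      rw [weakDeriv_zero]; exact HasValueAt.zero 0
  add_mem' := by
    rintro f g ⟨f1, f2, ⟨c, f3⟩, d, f4, f5⟩ ⟨g1, g2, ⟨c', g3⟩, d', g4, g5⟩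
    have e : ∀ j, weakDeriv ((f + g) j) = weakDeriv (f j) + weakDeriv (g j) := fun j =>
      weakDeriv_add (f1 j).1 (g1 j).1
    refine ⟨fun j => ⟨H1_add (f1 j).1 (g1 j).1, ?_⟩, fun j => ?_,
      ⟨c + c', fun j => (f3 j).add (g3 j)⟩, d + d', fun j => ?_, ?_⟩
    · rw [e j]; exact H1_add (f1 j).2 (g1 j).2
    · simpa using (f2 j).add (g2 j)
    · rw [e j]; exact (f4 j).add (g4 j)
    · simp [Finset.sum_add_distrib, f5, g5]
  smul_mem' := by
    rintro b f ⟨f1, f2, ⟨c, f3⟩, d, f4, f5⟩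
    have e : ∀ j, weakDeriv ((b • f) j) = b • weakDeriv (f j) := fun j =>
      weakDeriv_smul b (f1 j).1
    refine ⟨fun j => ⟨H1_smul b (f1 j).1, ?_⟩, fun j => ?_,
      ⟨b * c, fun j => (f3 j).smul b⟩, fun j => b * d j, fun j => ?_, ?_⟩
    · rw [e j]; exact H1_smul b (f1 j).2
    · simpa using (f2 j).smul b
    · rw [e j]; exact (f4 j).smul b
    · rw [← Finset.mul_sum, f5, mul_zero]

/-- The indefinite Kirchhoff Laplacian `B` on the star graph with `nP + nM` edges:
`-d²/dx²` on the first `nP` edges and `d²/dx²` on the last `nM` edges. -/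
def kirchhoffB (nP nM : ℕ) : L2G (nP + nM) →ₗ.[ℂ] L2G (nP + nM) where
  domain := kirchhoffDomain (nP + nM)
  toFun :=
    { toFun := fun f => WithLp.toLp 2 fun j =>
        if j.val < nP then - weakDeriv (weakDeriv (f.1 j)) else weakDeriv (weakDeriv (f.1 j))
      map_add' := by
        rintro ⟨f, f1, -⟩ ⟨g, g1, -⟩
        ext1 j
        have e : weakDeriv (weakDeriv ((f + g) j))
            = weakDeriv (weakDeriv (f j)) + weakDeriv (weakDeriv (g j)) := by
          rw [PiLp.add_apply, weakDeriv_add (f1 j).1 (g1 j).1, weakDeriv_add (f1 j).2 (g1 j).2]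
        change (if j.val < nP then - weakDeriv (weakDeriv ((f + g) j))
            else weakDeriv (weakDeriv ((f + g) j)))
          = (if j.val < nP then - weakDeriv (weakDeriv (f j)) else weakDeriv (weakDeriv (f j)))
          + (if j.val < nP then - weakDeriv (weakDeriv (g j)) else weakDeriv (weakDeriv (g j)))
        rw [e]
        split_ifs
        · exact neg_add _ _
        · rfl
      map_smul' := by
        rintro c ⟨f, f1, -⟩
        ext1 j
        have e : weakDeriv (weakDeriv ((c • f) j)) = c • weakDeriv (weakDeriv (f j)) := by
          rw [PiLp.smul_apply, weakDeriv_smul c (f1 j).1, weakDeriv_smul c (f1 j).2]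
        change (if j.val < nP then - weakDeriv (weakDeriv ((c • f) j))
            else weakDeriv (weakDeriv ((c • f) j)))
          = c • (if j.val < nP then - weakDeriv (weakDeriv (f j))
            else weakDeriv (weakDeriv (f j)))
        rw [e]
        split_ifs
        · exact (smul_neg _ _).symm
        · rfl }

/-- The point spectrum (set of eigenvalues) of an unbounded operator. -/
def pointSpectrum {H : Type*} [NormedAddCommGroup H] [NormedSpace ℂ H] (T : H →ₗ.[ℂ] H) :
    Set ℂ :=
  {z | ∃ x : T.domain, x ≠ 0 ∧ T x = z • (x : H)}

/-- The resolvent set of an unbounded operator: `T - z` maps the domain of `T` bijectively onto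
the whole space, with a bounded everywhere defined inverse `R`. -/
def opResolventSet {H : Type*} [NormedAddCommGroup H] [NormedSpace ℂ H] (T : H →ₗ.[ℂ] H) :
    Set ℂ :=
  {z | ∃ R : H →L[ℂ] H, (∀ y : H, ∃ h : R y ∈ T.domain, T ⟨R y, h⟩ - z • R y = y) ∧
    ∀ x : T.domain, R (T x - z • (x : H)) = x}

/-- The spectrum of an unbounded operator. -/
def opSpectrum {H : Type*} [NormedAddCommGroup H] [NormedSpace ℂ H] (T : H →ₗ.[ℂ] H) :
    Set ℂ :=
  (opResolventSet T)ᶜ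

/-- The hyperbolic cotangent. -/
def coth (x : ℝ) : ℝ := Real.cosh x / Real.sinh x

end StarGraph

end

noncomputable section

namespace StarGraph

/-! Fix `0 < k < π` and solve `B f - k² f = y` edge by edge. On each edge this reads `f'' = -ω² f +
ε y` with `ε = ∓1` and `ω = k` or `ω = i k`. Variation of constants gives the general solution, and
since neither `sin k` nor `sinh k` vanishes, the condition `f 1 = 0` fixes the solution in terms of
the common vertex value `γ` (`edgeSol_unique`, `edgeSol_spec`). Its slope at the vertex is affine in
`γ`, so the Kirchhoff condition becomes one scalar equation `γ · k · D(k) = -ℓ(y)`, where `D(k) = nP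
cot k + nM coth k` is `charFun` and `ℓ` is a bounded functional (`slope_sum`).

If `D(k) = 0`, then `y = 0`, `γ = 1` gives an eigenfunction; if `D(k) ≠ 0`, solving for `γ` gives a
bounded resolvent. On `(0, π)` the function `D` is strictly decreasing and has a zero `k₁`, so `η₁ =
k₁²`, and rearranging `D(k₁) = 0` gives the formula for the ratio.

If two operators have the same spectrum, then `k₁²`, an eigenvalue of the first, lies in the
spectrum of the second. As `k₁ < π`, the second function `D` also vanishes at `k₁`, and both ratios
equal the same expression in `k₁`. The rest of the spectrum is never computed. -/

/-! ### Weak derivatives as derivatives of primitives -/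

/-- Integration by parts against a primitive of an integrable function. -/
theorem mul_primitive_eq_integral {φ φ' g : ℝ → ℂ} {x : ℝ} (hx : 0 ≤ x)
    (hφ : ∀ t, HasDerivAt φ (φ' t) t) (hφ' : Continuous φ')
    (hg : IntervalIntegrable g volume 0 x) :
    φ x * ∫ t in (0 : ℝ)..x, g t =
      ∫ t in (0 : ℝ)..x, (φ' t * (∫ r in (0 : ℝ)..t, g r) + φ t * g t) := by
  have hφc : Continuous φ := continuous_iff_continuousAt.2 fun t => (hφ t).continuousAt
  have hG : ContinuousOn (fun t => ∫ r in (0 : ℝ)..t, g r) (uIcc 0 x) :=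
    intervalIntegral.continuousOn_primitive_interval' hg left_mem_uIcc
  have hi1 : IntervalIntegrable (fun t => φ' t * ∫ r in (0 : ℝ)..t, g r) volume 0 x :=
    (hφ'.continuousOn.mul hG).intervalIntegrable
  have hi2 : IntervalIntegrable (fun t => φ t * g t) volume 0 x :=
    hg.continuousOn_mul hφc.continuousOn
  rw [intervalIntegral.integral_add hi1 hi2]
  have hgx : IntegrableOn g (Ioc 0 x) := (intervalIntegrable_iff_integrableOn_Ioc_of_le hx).1 hg
  have hφx : IntegrableOn φ' (Ioc 0 x) :=
    (intervalIntegrable_iff_integrableOn_Ioc_of_le hx).1 (hφ'.intervalIntegrable 0 x)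
  -- Since `g` is merely integrable, the product rule is obtained from Fubini on the triangle `r ≤
  -- t` in place of pointwise differentiation.
  have hint : Integrable (Function.uncurry fun t r : ℝ =>
      {p : ℝ × ℝ | p.2 ≤ p.1}.indicator (fun p => φ' p.1 * g p.2) (t, r))
      ((volume.restrict (Ioc 0 x)).prod (volume.restrict (Ioc 0 x))) :=
    (Integrable.mul_prod hφx hgx).indicator (measurableSet_le measurable_snd measurable_fst)
  have e1 : ∫ t in (0 : ℝ)..x, φ' t * (∫ r in (0 : ℝ)..t, g r) =
      ∫ t in Ioc 0 x, ∫ r in Ioc 0 x,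
        {p : ℝ × ℝ | p.2 ≤ p.1}.indicator (fun p => φ' p.1 * g p.2) (t, r) := by
    rw [intervalIntegral.integral_of_le hx]
    refine setIntegral_congr_fun measurableSet_Ioc fun t ht => ?_
    have : (fun r => {p : ℝ × ℝ | p.2 ≤ p.1}.indicator (fun p => φ' p.1 * g p.2) (t, r)) =
        (Iic t).indicator fun r => φ' t * g r := by
      ext r; simp [indicator]
    simp only [this]
    rw [setIntegral_indicator measurableSet_Iic, Ioc_inter_Iic, min_eq_right ht.2,
      intervalIntegral.integral_of_le ht.1.le, integral_const_mul]
  have e2 : ∫ r in Ioc 0 x, ∫ t in Ioc 0 x,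
        {p : ℝ × ℝ | p.2 ≤ p.1}.indicator (fun p => φ' p.1 * g p.2) (t, r) =
      ∫ r in (0 : ℝ)..x, (φ x * g r - φ r * g r) := by
    rw [intervalIntegral.integral_of_le hx]
    refine setIntegral_congr_fun measurableSet_Ioc fun r hr => ?_
    have : (fun t => {p : ℝ × ℝ | p.2 ≤ p.1}.indicator (fun p => φ' p.1 * g p.2) (t, r)) =
        (Ici r).indicator fun t => φ' t * g r := by
      ext t; simp [indicator]
    have h3 : Ioc 0 x ∩ Ici r = Icc r x := by
      ext t; simp only [mem_inter_iff, mem_Ioc, mem_Ici, mem_Icc]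
      exact ⟨fun h => ⟨h.2, h.1.2⟩, fun h => ⟨⟨hr.1.trans_le h.1, h.2⟩, h.1⟩⟩
    simp only [this]
    rw [setIntegral_indicator measurableSet_Ici, h3, integral_Icc_eq_integral_Ioc,
      integral_mul_const, ← intervalIntegral.integral_of_le hr.2,
      intervalIntegral.integral_eq_sub_of_hasDerivAt (fun t _ => hφ t)
        (hφ'.intervalIntegrable r x), sub_mul]
  rw [e1, integral_integral_swap hint, e2,
    intervalIntegral.integral_sub (hg.const_mul _) hi2, intervalIntegral.integral_const_mul]
  ring

lemma intervalIntegrable_coeFn (g : L2I) {x : ℝ} (hx : x ∈ Icc (0 : ℝ) 1) :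
    IntervalIntegrable g volume 0 x := by
  have hf : Integrable g μI := (Lp.memLp g).integrable (by norm_num)
  have h : IntervalIntegrable g volume 0 1 :=
    (intervalIntegrable_iff_integrableOn_Ioo_of_le zero_le_one).2 hf
  exact h.mono_set (by rw [uIcc_of_le hx.1, uIcc_of_le zero_le_one]; exact Icc_subset_Icc_right hx.2)

lemma continuousOn_primitive_coeFn (g : L2I) :
    ContinuousOn (fun x => ∫ t in (0 : ℝ)..x, g t) (Icc 0 1) := by
  have := intervalIntegral.continuousOn_primitive_interval'
    (intervalIntegrable_coeFn g (right_mem_Icc.2 zero_le_one)) left_mem_uIcc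
  rwa [uIcc_of_le zero_le_one] at this

lemma setIntegral_Ioo_eq_intervalIntegral (F : ℝ → ℂ) :
    ∫ x in Ioo (0 : ℝ) 1, F x = ∫ x in (0 : ℝ)..1, F x := by
  rw [intervalIntegral.integral_of_le zero_le_one, integral_Ioc_eq_integral_Ioo]

/-- Integration by parts: test functions vanish at `0` and `1`, which removes the boundary term and
the contribution of the constant `a`. -/
lemma HasWeakDeriv.of_primitive {f g : L2I} (a : ℂ)
    (h : f =ᵐ[μI] fun x => a + ∫ t in (0 : ℝ)..x, g t) : HasWeakDeriv f g := by
  intro φ h1 h2 h3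
  have hφ0 : φ 0 = 0 := image_eq_zero_of_notMem_tsupport fun hx => by simpa using h3 hx
  have hφ1 : φ 1 = 0 := image_eq_zero_of_notMem_tsupport fun hx => by simpa using h3 hx
  have hd : ∀ t, HasDerivAt (fun x => (φ x : ℂ)) ((deriv φ t : ℝ) : ℂ) t := fun t =>
    ((h1.differentiable (by simp)) t).hasDerivAt.ofReal_comp
  have hdc : Continuous fun t => ((deriv φ t : ℝ) : ℂ) :=
    Complex.continuous_ofReal.comp (h1.continuous_deriv (by simp))
  have hg := intervalIntegrable_coeFn g (right_mem_Icc.2 zero_le_one)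
  have key := mul_primitive_eq_integral zero_le_one hd hdc hg
  have hG : ContinuousOn (fun x => ∫ t in (0 : ℝ)..x, g t) (uIcc 0 1) := by
    rw [uIcc_of_le zero_le_one]; exact continuousOn_primitive_coeFn g
  have hφc : Continuous fun t => (φ t : ℂ) := Complex.continuous_ofReal.comp h1.continuous
  have hdG : IntervalIntegrable (fun x => ((deriv φ x : ℝ) : ℂ) * ∫ t in (0 : ℝ)..x, g t)
      volume 0 1 := (hdc.continuousOn.mul hG).intervalIntegrable
  have hda : IntervalIntegrable (fun x => ((deriv φ x : ℝ) : ℂ) * a) volume 0 1 :=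
    (hdc.mul continuous_const).intervalIntegrable 0 1
  rw [intervalIntegral.integral_add hdG
    (hg.continuousOn_mul hφc.continuousOn), hφ1, Complex.ofReal_zero, zero_mul] at key
  have e1 : ∫ x in Ioo (0 : ℝ) 1, deriv φ x • f x =
      ∫ x in Ioo (0 : ℝ) 1, (((deriv φ x : ℝ) : ℂ) * a + ((deriv φ x : ℝ) : ℂ) * ∫ t in (0 : ℝ)..x, g t) := by
    refine integral_congr_ae ?_
    filter_upwards [h] with x hx
    rw [hx, Complex.real_smul, mul_add]
  have e0 : ∫ x in (0 : ℝ)..1, ((deriv φ x : ℝ) : ℂ) * a = 0 := by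
    rw [intervalIntegral.integral_mul_const,
      intervalIntegral.integral_eq_sub_of_hasDerivAt (fun t _ => hd t)
        (hdc.intervalIntegrable 0 1), hφ0, hφ1]
    simp
  rw [e1, setIntegral_Ioo_eq_intervalIntegral, setIntegral_Ioo_eq_intervalIntegral,
    intervalIntegral.integral_add hda hdG, e0]
  simp only [Complex.real_smul]
  linear_combination -key

lemma memLp_of_continuousOn {u : ℝ → ℂ} (hu : ContinuousOn u (Icc 0 1)) : MemLp u 2 μI := by
  obtain ⟨C, hC⟩ := isCompact_Icc.exists_bound_of_continuousOn hu
  refine MemLp.of_bound ((hu.mono Ioo_subset_Icc_self).aestronglyMeasurable measurableSet_Ioo) C ?_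
  exact (ae_restrict_iff' measurableSet_Ioo).2 (.of_forall fun x hx => hC x (Ioo_subset_Icc_self hx))

/-- A smooth function with compact support in `(0,1)` and vanishing integral is the derivative of
a function of the same kind. -/
lemma exists_primitive_test {ψ : ℝ → ℝ} (h1 : ContDiff ℝ (⊤ : ℕ∞) ψ) (h2 : HasCompactSupport ψ)
    (h3 : tsupport ψ ⊆ Ioo (0 : ℝ) 1) (h0 : ∫ x in (0 : ℝ)..1, ψ x = 0) :
    ∃ φ : ℝ → ℝ, ContDiff ℝ (⊤ : ℕ∞) φ ∧ HasCompactSupport φ ∧ tsupport φ ⊆ Ioo (0 : ℝ) 1 ∧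
      deriv φ = ψ := by
  have hd : ∀ x, HasDerivAt (fun x => ∫ t in (0 : ℝ)..x, ψ t) (ψ x) x := fun x =>
    h1.continuous.integral_hasStrictDerivAt 0 x |>.hasDerivAt
  have hd' : deriv (fun x => ∫ t in (0 : ℝ)..x, ψ t) = ψ := funext fun x => (hd x).deriv
  -- A compact interval strictly inside `(0,1)` is needed: the primitive of `ψ` vanishes left of `a`
  -- trivially, and right of `b` because the total integral is `0`.
  obtain ⟨a, b, ha, hb, hab⟩ : ∃ a b : ℝ, 0 < a ∧ b < 1 ∧ tsupport ψ ⊆ Icc a b := by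
    rcases (tsupport ψ).eq_empty_or_nonempty with he | hne
    · exact ⟨1/2, 1/2, by norm_num, by norm_num, by simp [he]⟩
    · exact ⟨sInf (tsupport ψ), sSup (tsupport ψ), (h3 (h2.isCompact.sInf_mem hne)).1,
        (h3 (h2.isCompact.sSup_mem hne)).2, fun x hx =>
        ⟨csInf_le h2.isCompact.bddBelow hx, le_csSup h2.isCompact.bddAbove hx⟩⟩
  have hz : ∀ t, t ∉ Icc a b → ψ t = 0 := fun t ht =>
    image_eq_zero_of_notMem_tsupport fun h => ht (hab h)
  have hs : Function.support (fun x => ∫ t in (0 : ℝ)..x, ψ t) ⊆ Icc a b := by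
    intro x hx
    by_contra hxab
    apply hx
    rcases lt_or_ge x a with hxa | hxa
    · refine intervalIntegral.integral_zero_ae (.of_forall fun t ht => hz t fun h => ?_)
      rcases le_total 0 x with h0x | h0x
      · rw [uIoc_of_le h0x] at ht; linarith [ht.2, h.1]
      · rw [uIoc_of_ge h0x] at ht; linarith [ht.2, h.1]
    · have hbx : b < x := not_le.1 fun h => hxab ⟨hxa, h⟩
      have e := intervalIntegral.integral_add_adjacent_intervals
        (h1.continuous.intervalIntegrable (μ := volume) 0 1)
        (h1.continuous.intervalIntegrable 1 x)
      have e2 : ∫ t in (1 : ℝ)..x, ψ t = 0 := by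
        refine intervalIntegral.integral_zero_ae (.of_forall fun t ht => hz t fun h => ?_)
        rcases le_total 1 x with h0x | h0x
        · rw [uIoc_of_le h0x] at ht; linarith [ht.1, h.2]
        · rw [uIoc_of_ge h0x] at ht; linarith [ht.1, h.2]
      simp only
      rw [← e, h0, e2, add_zero]
  have hts : tsupport (fun x => ∫ t in (0 : ℝ)..x, ψ t) ⊆ Icc a b :=
    closure_minimal hs isClosed_Icc
  refine ⟨_, ?_, HasCompactSupport.of_support_subset_isCompact isCompact_Icc hs,
    hts.trans fun x hx => ⟨ha.trans_le hx.1, hx.2.trans_lt hb⟩, hd'⟩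
  refine contDiff_infty_iff_deriv.2 ⟨fun x => (hd x).differentiableAt, ?_⟩
  rw [hd']; exact h1

/-- The lemma of du Bois-Reymond. -/
lemma HasWeakDeriv.ae_const {f : L2I} (h : HasWeakDeriv f 0) :
    ∃ a : ℂ, f =ᵐ[μI] fun _ => a := by
  obtain ⟨ρ, hρs, hρc, hρd, hρi⟩ : ∃ ρ : ℝ → ℝ, tsupport ρ ⊆ Ioo (0 : ℝ) 1 ∧
      HasCompactSupport ρ ∧ ContDiff ℝ (⊤ : ℕ∞) ρ ∧ ∫ x in (0 : ℝ)..1, ρ x = 1 := by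
    let b : ContDiffBump (1/2 : ℝ) := ⟨1/8, 1/4, by norm_num, by norm_num⟩
    have hs : tsupport (b.normed volume) ⊆ Ioo (0 : ℝ) 1 := by
      rw [b.tsupport_normed_eq, Real.closedBall_eq_Icc]
      intro x hx
      have h1 := hx.1
      have h2 := hx.2
      simp only [b] at h1 h2
      constructor <;> linarith
    refine ⟨b.normed volume, hs, b.hasCompactSupport_normed, b.contDiff_normed, ?_⟩
    rw [intervalIntegral.integral_of_le zero_le_one, setIntegral_eq_integral_of_forall_compl_eq_zero,
      b.integral_normed]
    intro x hx
    exact image_eq_zero_of_notMem_tsupport fun h => hx (Ioo_subset_Ioc_self (hs h))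
  have hfi : Integrable f μI := (Lp.memLp f).integrable (by norm_num)
  -- As `ρ` has integral `1`, a constant function must equal its own pairing with `ρ`.
  set a : ℂ := ∫ x in Ioo (0 : ℝ) 1, ρ x • f x with ha
  refine ⟨a, ?_⟩
  have key : ∀ᵐ x ∂(volume : Measure ℝ), x ∈ Ioo (0 : ℝ) 1 → f x - a = 0 := by
    refine IsOpen.ae_eq_zero_of_integral_contDiff_smul_eq_zero isOpen_Ioo
      (IntegrableOn.locallyIntegrableOn (hfi.sub (integrable_const a))) ?_
    intro φ h1 h2 h3
    change ∫ x, φ x • (f x - a) = 0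
    have hz : ∀ x, x ∉ Ioo (0 : ℝ) 1 → φ x • (f x - a) = 0 := by
      intro x hx
      have : φ x = 0 := image_eq_zero_of_notMem_tsupport (fun hx' => hx (h3 hx'))
      rw [this, zero_smul]
    rw [← setIntegral_eq_integral_of_forall_compl_eq_zero hz]
    set m : ℝ := ∫ x in (0 : ℝ)..1, φ x with hm
    -- Subtracting `m ρ` makes the mean zero, so `φ - m ρ` is the derivative of a test function and
    -- pairs to zero with `f`.
    have hsub : tsupport (fun x => φ x - m * ρ x) ⊆ tsupport φ ∪ tsupport ρ := by
      refine closure_minimal (fun x hx => ?_) ((isClosed_tsupport _).union (isClosed_tsupport _))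
      by_contra hcon
      rw [mem_union, not_or] at hcon
      apply hx
      simp [image_eq_zero_of_notMem_tsupport hcon.1, image_eq_zero_of_notMem_tsupport hcon.2]
    have hmρ : IntervalIntegrable (fun x => m * ρ x) volume 0 1 :=
      (continuous_const.mul hρd.continuous).intervalIntegrable 0 1
    obtain ⟨χ, g1, g2, g3, g4⟩ := exists_primitive_test (ψ := fun x => φ x - m * ρ x)
      (h1.sub (contDiff_const.mul hρd))
      (HasCompactSupport.of_support_subset_isCompact (h2.isCompact.union hρc.isCompact)
        (subset_closure.trans hsub)) (hsub.trans (union_subset h3 hρs)) (by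
        rw [intervalIntegral.integral_sub (h1.continuous.intervalIntegrable 0 1) hmρ,
          intervalIntegral.integral_const_mul, hρi, mul_one, hm, sub_self])
    have e := h χ g1 g2 g3
    have e0 : ∫ x in Ioo (0 : ℝ) 1, χ x • (0 : L2I) x = 0 := by
      refine integral_eq_zero_of_ae ?_
      filter_upwards [Lp.coeFn_zero ℂ 2 μI] with x hx
      rw [hx]; simp
    rw [e0, neg_zero, g4] at e
    have hmi : Integrable (fun x => m • ρ x • f x) μI := (integrable_test f hρd.continuous hρc).smul m
    have e1 : ∫ x in Ioo (0 : ℝ) 1, (φ x - m * ρ x) • f x =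
        (∫ x in Ioo (0 : ℝ) 1, φ x • f x) - m • a := by
      rw [ha, ← integral_smul, ← integral_sub (integrable_test f h1.continuous h2) hmi]
      refine integral_congr_ae (.of_forall fun x => ?_)
      simp only [Complex.real_smul]
      push_cast
      ring
    have e2 : ∫ x in Ioo (0 : ℝ) 1, φ x • a = m • a := by
      rw [integral_smul_const, hm, intervalIntegral.integral_of_le zero_le_one,
        integral_Ioc_eq_integral_Ioo]
    have hic : Integrable (fun x => φ x • a) μI :=
      (h1.continuous.integrable_of_hasCompactSupport h2).integrableOn.smul_const a
    simp only [smul_sub]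
    rw [integral_sub (integrable_test f h1.continuous h2) hic, e2, ← e1, e]
  rw [Filter.EventuallyEq, ae_restrict_iff' measurableSet_Ioo]
  filter_upwards [key] with x hx hx'
  exact sub_eq_zero.mp (hx hx')

/-- The primitive of `g` also has weak derivative `g`, so its difference from `f` is constant by du
Bois-Reymond. -/
lemma HasWeakDeriv.exists_primitive {f g : L2I} (h : HasWeakDeriv f g) :
    ∃ a : ℂ, f =ᵐ[μI] fun x => a + ∫ t in (0 : ℝ)..x, g t := by
  have hm := memLp_of_continuousOn (continuousOn_primitive_coeFn g)
  have hG : HasWeakDeriv (hm.toLp _) g := .of_primitive 0 (by simpa using hm.coeFn_toLp)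
  have h0 : HasWeakDeriv (f + (-1 : ℂ) • hm.toLp _) 0 := by
    simpa using h.add (hG.smul (-1))
  obtain ⟨a, ha⟩ := h0.ae_const
  refine ⟨a, ?_⟩
  filter_upwards [ha, hm.coeFn_toLp, Lp.coeFn_add f ((-1 : ℂ) • hm.toLp _),
    Lp.coeFn_smul (-1 : ℂ) (hm.toLp _)] with x h1 h2 h3 h4
  rw [h3, Pi.add_apply, h4, Pi.smul_apply, h2] at h1
  rw [← h1]; simp

/-! ### Continuous representatives and their boundary values -/

lemma eqOn_Icc_of_ae_eq {u v : ℝ → ℂ} (hu : ContinuousOn u (Icc 0 1))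
    (hv : ContinuousOn v (Icc 0 1)) (h : u =ᵐ[μI] v) : EqOn u v (Icc 0 1) := by
  have h1 : EqOn u v (Ioo 0 1) := Measure.eqOn_open_of_ae_eq h isOpen_Ioo
    (hu.mono Ioo_subset_Icc_self) (hv.mono Ioo_subset_Icc_self)
  exact h1.of_subset_closure hu hv Ioo_subset_Icc_self (by rw [closure_Ioo zero_ne_one])

lemma HasValueAt.unique {f : L2I} {a : ℝ} {c d : ℂ} (ha : a ∈ Icc (0 : ℝ) 1)
    (h : HasValueAt f a c) (h' : HasValueAt f a d) : c = d := by
  obtain ⟨u, hu, hfu, rfl⟩ := h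
  obtain ⟨v, hv, hfv, rfl⟩ := h'
  exact eqOn_Icc_of_ae_eq hu hv (hfu.symm.trans hfv) ha

/-- The class in `L²((0,1))` of a function that is continuous on `[0,1]`. -/
def ofContinuousOn (u : ℝ → ℂ) (hu : ContinuousOn u (Icc 0 1)) : L2I :=
  (memLp_of_continuousOn hu).toLp u

lemma coeFn_ofContinuousOn {u : ℝ → ℂ} (hu : ContinuousOn u (Icc 0 1)) :
    ofContinuousOn u hu =ᵐ[μI] u := (memLp_of_continuousOn hu).coeFn_toLp

lemma hasValueAt_ofContinuousOn {u : ℝ → ℂ} (hu : ContinuousOn u (Icc 0 1)) (a : ℝ) :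
    HasValueAt (ofContinuousOn u hu) a (u a) := ⟨u, hu, coeFn_ofContinuousOn hu, rfl⟩

/-- If two functions agree almost everywhere on `(0,1)`, their primitives agree on `[0,1]`. -/
lemma integral_congr_of_ae_eq {f g : ℝ → ℂ} (h : f =ᵐ[μI] g) {x : ℝ} (hx : x ∈ Icc (0 : ℝ) 1) :
    ∫ t in (0 : ℝ)..x, f t = ∫ t in (0 : ℝ)..x, g t := by
  rw [intervalIntegral.integral_of_le hx.1, intervalIntegral.integral_of_le hx.1,
    integral_Ioc_eq_integral_Ioo, integral_Ioc_eq_integral_Ioo]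
  exact integral_congr_ae (ae_restrict_of_ae_restrict_of_subset (Ioo_subset_Ioo_right hx.2) h)

lemma hasWeakDeriv_of_eq_primitive {u : ℝ → ℂ} (hu : ContinuousOn u (Icc 0 1)) {g : L2I} {v : ℝ → ℂ}
    (hg : g =ᵐ[μI] v) (a : ℂ) (h : ∀ x ∈ Icc (0 : ℝ) 1, u x = a + ∫ t in (0 : ℝ)..x, v t) :
    HasWeakDeriv (ofContinuousOn u hu) g := by
  refine .of_primitive a ?_
  filter_upwards [coeFn_ofContinuousOn hu, ae_restrict_mem measurableSet_Ioo] with x hx hx'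
  rw [hx, h x (Ioo_subset_Icc_self hx'), integral_congr_of_ae_eq hg (Ioo_subset_Icc_self hx')]

lemma hasWeakDeriv_of_hasDerivAt {u v : ℝ → ℂ} (h : ∀ x, HasDerivAt u (v x) x)
    (hu : ContinuousOn u (Icc 0 1)) (hv : Continuous v) {g : L2I} (hg : g =ᵐ[μI] v) :
    HasWeakDeriv (ofContinuousOn u hu) g :=
  hasWeakDeriv_of_eq_primitive hu hg (u 0) fun x _ => by
    rw [intervalIntegral.integral_eq_sub_of_hasDerivAt (fun t _ => h t) (hv.intervalIntegrable 0 x)]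
    ring

/-- An element of `H¹` whose weak derivative is continuous has a differentiable representative. -/
lemma HasWeakDeriv.exists_hasDerivAt {f g : L2I} (h : HasWeakDeriv f g) {v : ℝ → ℂ}
    (hv : ContinuousOn v (Icc 0 1)) (hg : g =ᵐ[μI] v) :
    ∃ u : ℝ → ℂ, (∀ x ∈ Icc (0 : ℝ) 1, HasDerivAt u (v x) x) ∧ f =ᵐ[μI] u := by
  obtain ⟨a, ha⟩ := h.exists_primitive
  -- Extending `v` by constants beyond `[0,1]` makes the primitive differentiable from both sides at
  -- the endpoints too.
  have hc : Continuous (IccExtend (zero_le_one' ℝ) ((Icc (0 : ℝ) 1).domRestrict v)) :=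
    hv.domRestrict.Icc_extend'
  have he : ∀ x ∈ Icc (0 : ℝ) 1, IccExtend (zero_le_one' ℝ) ((Icc (0 : ℝ) 1).domRestrict v) x = v x :=
    fun x hx => by rw [IccExtend_of_mem _ _ hx]; rfl
  refine ⟨fun x => a + ∫ t in (0 : ℝ)..x, IccExtend (zero_le_one' ℝ) ((Icc (0 : ℝ) 1).domRestrict v) t,
    fun x hx => ?_, ?_⟩
  · have := (hc.integral_hasStrictDerivAt 0 x).hasDerivAt.const_add a
    rwa [he x hx] at this
  · filter_upwards [ha, ae_restrict_mem measurableSet_Ioo] with x hx hx'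
    rw [hx]
    congr 1
    refine integral_congr_of_ae_eq (hg.trans ?_) (Ioo_subset_Icc_self hx')
    filter_upwards [ae_restrict_mem measurableSet_Ioo] with t ht
    rw [he t (Ioo_subset_Icc_self ht)]

/-! ### The equation `f'' = -ω² f + y` on an edge -/

/-- The solution of `u'' = -ω² u` with `u 0 = 0` and `u' 0 = 1`. -/
def sn (ω : ℂ) (x : ℝ) : ℂ := Complex.sin (ω * x) / ω

/-- The solution of `u'' = -ω² u` with `u 0 = 1` and `u' 0 = 0`. -/
def cs (ω : ℂ) (x : ℝ) : ℂ := Complex.cos (ω * x)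

@[simp] lemma sn_zero (ω : ℂ) : sn ω 0 = 0 := by simp [sn]

@[simp] lemma cs_zero (ω : ℂ) : cs ω 0 = 1 := by simp [cs]

lemma continuous_sn (ω : ℂ) : Continuous (sn ω) := by unfold sn; fun_prop

lemma continuous_cs (ω : ℂ) : Continuous (cs ω) := by unfold cs; fun_prop

section

variable {ω : ℂ}

lemma hasDerivAt_sn (hω : ω ≠ 0) (x : ℝ) : HasDerivAt (sn ω) (cs ω x) x := by
  have h1 : HasDerivAt (fun z : ℂ => Complex.sin (ω * z) / ω) (cs ω x) (x : ℂ) := by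
    have h : HasDerivAt (fun z : ℂ => ω * z) ω (x : ℂ) := by
      simpa using (hasDerivAt_id (x : ℂ)).const_mul ω
    exact (h.csin.div_const ω).congr_deriv (mul_div_cancel_right₀ _ hω)
  exact h1.comp_ofReal

lemma hasDerivAt_cs (hω : ω ≠ 0) (x : ℝ) : HasDerivAt (cs ω) (-ω ^ 2 * sn ω x) x := by
  have h1 : HasDerivAt (fun z : ℂ => Complex.cos (ω * z)) (-ω ^ 2 * sn ω x) (x : ℂ) := by
    have h : HasDerivAt (fun z : ℂ => ω * z) ω (x : ℂ) := by
      simpa using (hasDerivAt_id (x : ℂ)).const_mul ω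
    refine h.ccos.congr_deriv ?_
    rw [sn]
    field_simp
  exact h1.comp_ofReal

/-- This is the Wronskian of `cs ω` and `sn ω`, identically `1`. -/
lemma cs_sq_add (hω : ω ≠ 0) (x : ℝ) : cs ω x ^ 2 + ω ^ 2 * sn ω x ^ 2 = 1 := by
  rw [cs, sn, div_pow, mul_div_cancel₀ _ (pow_ne_zero 2 hω), add_comm, Complex.sin_sq_add_cos_sq]

/-- `sn ω` as an element of `L²((0,1))`. -/
def snL (ω : ℂ) : L2I := ofContinuousOn (sn ω) (continuous_sn ω).continuousOn

/-- `cs ω` as an element of `L²((0,1))`. -/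
def csL (ω : ℂ) : L2I := ofContinuousOn (cs ω) (continuous_cs ω).continuousOn

lemma hasWeakDeriv_snL (hω : ω ≠ 0) : HasWeakDeriv (snL ω) (csL ω) :=
  hasWeakDeriv_of_hasDerivAt (hasDerivAt_sn hω) _ (continuous_cs ω) (coeFn_ofContinuousOn _)

lemma hasWeakDeriv_csL (hω : ω ≠ 0) : HasWeakDeriv (csL ω) ((-ω ^ 2) • snL ω) := by
  refine hasWeakDeriv_of_hasDerivAt (hasDerivAt_cs hω) _ (continuous_const.mul (continuous_sn ω)) ?_
  filter_upwards [Lp.coeFn_smul (-ω ^ 2) (snL ω),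
    coeFn_ofContinuousOn (continuous_sn ω).continuousOn] with x h1 h2
  rw [h1, Pi.smul_apply, snL, h2, smul_eq_mul]

/-! ### Variation of constants -/

/-- The solution of `u'' = -ω² u + y` with `u 0 = u' 0 = 0`. -/
def volterra (ω : ℂ) (y : L2I) (x : ℝ) : ℂ :=
  sn ω x * (∫ t in (0 : ℝ)..x, cs ω t * y t) - cs ω x * ∫ t in (0 : ℝ)..x, sn ω t * y t

/-- The derivative of `volterra ω y`. -/
def volterraDeriv (ω : ℂ) (y : L2I) (x : ℝ) : ℂ :=
  cs ω x * (∫ t in (0 : ℝ)..x, cs ω t * y t) + ω ^ 2 * (sn ω x * ∫ t in (0 : ℝ)..x, sn ω t * y t)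

lemma intervalIntegrable_mul_coeFn {φ : ℝ → ℂ} (hφ : Continuous φ) (y : L2I) {x : ℝ}
    (hx : x ∈ Icc (0 : ℝ) 1) : IntervalIntegrable (fun t => φ t * y t) volume 0 x :=
  (intervalIntegrable_coeFn y hx).continuousOn_mul hφ.continuousOn

lemma continuousOn_primitive_mul {φ : ℝ → ℂ} (hφ : Continuous φ) (y : L2I) :
    ContinuousOn (fun x => ∫ t in (0 : ℝ)..x, φ t * y t) (Icc 0 1) := by
  have := intervalIntegral.continuousOn_primitive_interval'
    (intervalIntegrable_mul_coeFn hφ y (right_mem_Icc.2 zero_le_one)) left_mem_uIcc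
  rwa [uIcc_of_le zero_le_one] at this

lemma continuousOn_volterra (ω : ℂ) (y : L2I) : ContinuousOn (volterra ω y) (Icc 0 1) :=
  ((continuous_sn ω).continuousOn.mul (continuousOn_primitive_mul (continuous_cs ω) y)).sub
    ((continuous_cs ω).continuousOn.mul (continuousOn_primitive_mul (continuous_sn ω) y))

lemma continuousOn_volterraDeriv (ω : ℂ) (y : L2I) : ContinuousOn (volterraDeriv ω y) (Icc 0 1) :=
  ((continuous_cs ω).continuousOn.mul (continuousOn_primitive_mul (continuous_cs ω) y)).add
    (continuousOn_const.mul
      ((continuous_sn ω).continuousOn.mul (continuousOn_primitive_mul (continuous_sn ω) y)))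

@[simp] lemma volterra_zero (ω : ℂ) (y : L2I) : volterra ω y 0 = 0 := by simp [volterra]

@[simp] lemma volterraDeriv_zero (ω : ℂ) (y : L2I) : volterraDeriv ω y 0 = 0 := by
  simp [volterraDeriv]

/-- Product rule for a differentiable function times a primitive, integrated. -/
lemma mul_primitive_mul_eq_integral {ψ ψ' φ : ℝ → ℂ} (hψ : ∀ t, HasDerivAt ψ (ψ' t) t)
    (hψ' : Continuous ψ') (hφ : Continuous φ) (y : L2I) {x : ℝ} (hx : x ∈ Icc (0 : ℝ) 1) :
    IntervalIntegrable
      (fun t => ψ' t * (∫ r in (0 : ℝ)..t, φ r * y r) + ψ t * (φ t * y t)) volume 0 x ∧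
    ψ x * ∫ t in (0 : ℝ)..x, φ t * y t =
      ∫ t in (0 : ℝ)..x, (ψ' t * (∫ r in (0 : ℝ)..t, φ r * y r) + ψ t * (φ t * y t)) := by
  have hi := intervalIntegrable_mul_coeFn hφ y hx
  refine ⟨IntervalIntegrable.add ?_ (hi.continuousOn_mul
    (continuous_iff_continuousAt.2 fun t => (hψ t).continuousAt).continuousOn),
    mul_primitive_eq_integral hx.1 hψ hψ' hi⟩
  refine ContinuousOn.intervalIntegrable (hψ'.continuousOn.mul ?_)
  rw [uIcc_of_le hx.1]
  exact (continuousOn_primitive_mul hφ y).mono (Icc_subset_Icc_right hx.2)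

/-- In the product rule the two terms containing `y` without an integral cancel. The integrated form
is used because `y` is only in `L²`. -/
lemma volterra_eq_integral (hω : ω ≠ 0) (y : L2I) {x : ℝ} (hx : x ∈ Icc (0 : ℝ) 1) :
    volterra ω y x = ∫ t in (0 : ℝ)..x, volterraDeriv ω y t := by
  obtain ⟨i1, e1⟩ := mul_primitive_mul_eq_integral (hasDerivAt_sn hω) (continuous_cs ω)
    (continuous_cs ω) y hx
  obtain ⟨i2, e2⟩ := mul_primitive_mul_eq_integral (hasDerivAt_cs hω)
    (continuous_const.mul (continuous_sn ω)) (continuous_sn ω) y hx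
  rw [volterra, e1, e2, ← intervalIntegral.integral_sub i1 i2]
  refine intervalIntegral.integral_congr fun t _ => ?_
  simp only [volterraDeriv]
  ring

/-- Here the terms containing `y` without an integral add up to the Wronskian times `y`, which is
`y` itself. -/
lemma volterraDeriv_eq_integral (hω : ω ≠ 0) (y : L2I) {x : ℝ} (hx : x ∈ Icc (0 : ℝ) 1) :
    volterraDeriv ω y x = ∫ t in (0 : ℝ)..x, (-ω ^ 2 * volterra ω y t + y t) := by
  obtain ⟨i1, e1⟩ := mul_primitive_mul_eq_integral (hasDerivAt_cs hω)
    (continuous_const.mul (continuous_sn ω)) (continuous_cs ω) y hx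
  obtain ⟨i2, e2⟩ := mul_primitive_mul_eq_integral (hasDerivAt_sn hω) (continuous_cs ω)
    (continuous_sn ω) y hx
  rw [volterraDeriv, e1, e2, ← intervalIntegral.integral_const_mul,
    ← intervalIntegral.integral_add i1 (i2.const_mul _)]
  refine intervalIntegral.integral_congr fun t _ => ?_
  simp only [volterra]
  linear_combination y t * cs_sq_add hω t

lemma exists_bound_primitive_mul {φ : ℝ → ℂ} (hφ : Continuous φ) :
    ∃ C : ℝ, ∀ y : L2I, ∀ x ∈ Icc (0 : ℝ) 1, ‖∫ t in (0 : ℝ)..x, φ t * y t‖ ≤ C * ‖y‖ := by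
  obtain ⟨C, hC⟩ := (isCompact_Icc (a := (0 : ℝ)) (b := 1)).exists_bound_of_continuousOn
    hφ.continuousOn
  have hC0 : 0 ≤ C := (norm_nonneg _).trans (hC 0 (left_mem_Icc.2 zero_le_one))
  refine ⟨C, fun y x hx => ?_⟩
  have : IsProbabilityMeasure μI := ⟨by simp⟩
  have hy : Integrable y μI := (Lp.memLp y).integrable (by norm_num)
  -- On a probability space the `L¹` norm is at most the `L²` norm.
  have h1 : ∫ t in Ioo (0 : ℝ) 1, ‖y t‖ ≤ ‖y‖ := by
    rw [integral_norm_eq_lintegral_enorm hy.1, ← eLpNorm_one_eq_lintegral_enorm, Lp.norm_def]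
    exact ENNReal.toReal_mono (Lp.eLpNorm_ne_top y)
      (eLpNorm_le_eLpNorm_of_exponent_le (by norm_num) hy.1)
  calc ‖∫ t in (0 : ℝ)..x, φ t * y t‖ ≤ ∫ t in (0 : ℝ)..x, ‖φ t * y t‖ :=
        intervalIntegral.norm_integral_le_integral_norm hx.1
    _ = ∫ t in Ioo 0 x, ‖φ t * y t‖ := by
        rw [intervalIntegral.integral_of_le hx.1, integral_Ioc_eq_integral_Ioo]
    _ ≤ ∫ t in Ioo 0 x, C * ‖y t‖ := by
        have hs : Ioo 0 x ⊆ Ioo (0 : ℝ) 1 := Ioo_subset_Ioo_right hx.2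
        refine setIntegral_mono_on ?_ ?_ measurableSet_Ioo fun t ht => ?_
        · exact ((intervalIntegrable_iff_integrableOn_Ioo_of_le hx.1).1
            (intervalIntegrable_mul_coeFn hφ y hx)).norm
        · exact (IntegrableOn.mono_set (t := Ioo (0 : ℝ) 1) (hy.norm.const_mul C) hs)
        · rw [norm_mul]
          exact mul_le_mul_of_nonneg_right (hC t (Ioo_subset_Icc_self (hs ht))) (norm_nonneg _)
    _ ≤ ∫ t in Ioo (0 : ℝ) 1, C * ‖y t‖ :=
        setIntegral_mono_set (hy.norm.const_mul C)
          (.of_forall fun t => mul_nonneg hC0 (norm_nonneg _))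
          (Ioo_subset_Ioo_right hx.2).eventuallyLE
    _ ≤ C * ‖y‖ := by
        rw [integral_const_mul]; exact mul_le_mul_of_nonneg_left h1 hC0

lemma exists_bound_volterra (ω : ℂ) :
    ∃ C : ℝ, ∀ y : L2I, ∀ x ∈ Icc (0 : ℝ) 1, ‖volterra ω y x‖ ≤ C * ‖y‖ := by
  obtain ⟨A, hA⟩ := exists_bound_primitive_mul (continuous_cs ω)
  obtain ⟨B, hB⟩ := exists_bound_primitive_mul (continuous_sn ω)
  obtain ⟨S, hS⟩ := (isCompact_Icc (a := (0 : ℝ)) (b := 1)).exists_bound_of_continuousOn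
    (continuous_sn ω).continuousOn
  obtain ⟨T, hT⟩ := (isCompact_Icc (a := (0 : ℝ)) (b := 1)).exists_bound_of_continuousOn
    (continuous_cs ω).continuousOn
  refine ⟨S * A + T * B, fun y x hx => ?_⟩
  calc ‖volterra ω y x‖ ≤ _ := norm_sub_le _ _
    _ ≤ S * (A * ‖y‖) + T * (B * ‖y‖) := by
        rw [norm_mul, norm_mul]
        exact add_le_add
          (mul_le_mul (hS x hx) (hA y x hx) (norm_nonneg _) ((norm_nonneg _).trans (hS x hx)))
          (mul_le_mul (hT x hx) (hB y x hx) (norm_nonneg _) ((norm_nonneg _).trans (hT x hx)))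
    _ = (S * A + T * B) * ‖y‖ := by ring

lemma primitive_mul_add {φ : ℝ → ℂ} (hφ : Continuous φ) (y z : L2I) {x : ℝ}
    (hx : x ∈ Icc (0 : ℝ) 1) : ∫ t in (0 : ℝ)..x, φ t * (y + z : L2I) t =
      (∫ t in (0 : ℝ)..x, φ t * y t) + ∫ t in (0 : ℝ)..x, φ t * z t := by
  rw [← intervalIntegral.integral_add (intervalIntegrable_mul_coeFn hφ y hx)
    (intervalIntegrable_mul_coeFn hφ z hx)]
  refine integral_congr_of_ae_eq ?_ hx
  filter_upwards [Lp.coeFn_add y z] with t ht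
  rw [ht, Pi.add_apply, mul_add]

lemma primitive_mul_smul (φ : ℝ → ℂ) (c : ℂ) (y : L2I) {x : ℝ}
    (hx : x ∈ Icc (0 : ℝ) 1) : ∫ t in (0 : ℝ)..x, φ t * (c • y : L2I) t =
      c * ∫ t in (0 : ℝ)..x, φ t * y t := by
  rw [← intervalIntegral.integral_const_mul]
  refine integral_congr_of_ae_eq ?_ hx
  filter_upwards [Lp.coeFn_smul c y] with t ht
  rw [ht, Pi.smul_apply, smul_eq_mul]
  ring

lemma volterra_add (ω : ℂ) (y z : L2I) {x : ℝ} (hx : x ∈ Icc (0 : ℝ) 1) :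
    volterra ω (y + z) x = volterra ω y x + volterra ω z x := by
  simp only [volterra, primitive_mul_add (continuous_cs ω) y z hx,
    primitive_mul_add (continuous_sn ω) y z hx]
  ring

lemma volterra_smul (ω c : ℂ) (y : L2I) {x : ℝ} (hx : x ∈ Icc (0 : ℝ) 1) :
    volterra ω (c • y) x = c * volterra ω y x := by
  simp only [volterra, primitive_mul_smul _ c y hx]
  ring

/-- The value `volterra ω y 1` as a bounded functional of `y`. -/
def volterraEnd (ω : ℂ) : L2I →L[ℂ] ℂ :=
  LinearMap.mkContinuousOfExistsBound
    { toFun := fun y => volterra ω y 1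
      map_add' := fun y z => volterra_add ω y z (right_mem_Icc.2 zero_le_one)
      map_smul' := fun c y => volterra_smul ω c y (right_mem_Icc.2 zero_le_one) }
    (by
      obtain ⟨C, hC⟩ := exists_bound_volterra ω
      exact ⟨C, fun y => hC y 1 (right_mem_Icc.2 zero_le_one)⟩)

lemma volterraEnd_apply (ω : ℂ) (y : L2I) : volterraEnd ω y = volterra ω y 1 := rfl

/-- The bounded operator `y ↦ volterra ω y` of `L²((0,1))`. -/
def volterraL (ω : ℂ) : L2I →L[ℂ] L2I :=
  LinearMap.mkContinuousOfExistsBound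
    { toFun := fun y => ofContinuousOn (volterra ω y) (continuousOn_volterra ω y)
      map_add' := fun y z => by
        refine Lp.ext ?_
        filter_upwards [coeFn_ofContinuousOn (continuousOn_volterra ω (y + z)),
          coeFn_ofContinuousOn (continuousOn_volterra ω y),
          coeFn_ofContinuousOn (continuousOn_volterra ω z),
          Lp.coeFn_add (ofContinuousOn _ (continuousOn_volterra ω y))
            (ofContinuousOn _ (continuousOn_volterra ω z)),
          ae_restrict_mem measurableSet_Ioo] with x h1 h2 h3 h4 hx
        rw [h1, h4, Pi.add_apply, h2, h3, volterra_add ω y z (Ioo_subset_Icc_self hx)]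
      map_smul' := fun c y => by
        refine Lp.ext ?_
        filter_upwards [coeFn_ofContinuousOn (continuousOn_volterra ω (c • y)),
          coeFn_ofContinuousOn (continuousOn_volterra ω y),
          Lp.coeFn_smul c (ofContinuousOn _ (continuousOn_volterra ω y)),
          ae_restrict_mem measurableSet_Ioo] with x h1 h2 h4 hx
        rw [RingHom.id_apply, h1, h4, Pi.smul_apply, h2,
          volterra_smul ω c y (Ioo_subset_Icc_self hx), smul_eq_mul] }
    (by
      obtain ⟨C, hC⟩ := exists_bound_volterra ω
      refine ⟨measureUnivNNReal μI ^ (2 : ENNReal).toReal⁻¹ * |C|, fun y => ?_⟩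
      rw [mul_assoc]
      refine Lp.norm_le_of_ae_bound (by positivity) ?_
      filter_upwards [coeFn_ofContinuousOn (continuousOn_volterra ω y),
        ae_restrict_mem measurableSet_Ioo] with x h1 hx
      change ‖(ofContinuousOn (volterra ω y) (continuousOn_volterra ω y) : L2I) x‖ ≤ _
      rw [h1]
      exact (hC y x (Ioo_subset_Icc_self hx)).trans
        (mul_le_mul_of_nonneg_right (le_abs_self C) (norm_nonneg _)))

lemma volterraL_apply (ω : ℂ) (y : L2I) :
    volterraL ω y = ofContinuousOn (volterra ω y) (continuousOn_volterra ω y) := rfl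

/-- `volterraDeriv ω y` as an element of `L²((0,1))`. -/
def volterraDerivL (ω : ℂ) (y : L2I) : L2I :=
  ofContinuousOn (volterraDeriv ω y) (continuousOn_volterraDeriv ω y)

lemma hasWeakDeriv_volterraL (hω : ω ≠ 0) (y : L2I) :
    HasWeakDeriv (volterraL ω y) (volterraDerivL ω y) :=
  hasWeakDeriv_of_eq_primitive (continuousOn_volterra ω y) (coeFn_ofContinuousOn _) 0 fun x hx => by
    rw [volterra_eq_integral hω y hx, zero_add]

lemma hasWeakDeriv_volterraDerivL (hω : ω ≠ 0) (y : L2I) :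
    HasWeakDeriv (volterraDerivL ω y) ((-ω ^ 2) • volterraL ω y + y) := by
  refine hasWeakDeriv_of_eq_primitive (continuousOn_volterraDeriv ω y) (v := fun t => -ω ^ 2 * volterra ω y t + y t) ?_ 0
    fun x hx => ?_
  · filter_upwards [Lp.coeFn_add ((-ω ^ 2) • volterraL ω y) y,
      Lp.coeFn_smul (-ω ^ 2) (volterraL ω y),
      coeFn_ofContinuousOn (continuousOn_volterra ω y)] with x h1 h2 h3
    rw [h1, Pi.add_apply, h2, Pi.smul_apply, volterraL_apply, h3, smul_eq_mul]
  · rw [volterraDeriv_eq_integral hω y hx, zero_add]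

/-! ### Uniqueness for the equation on an edge -/

/-- The quantities `u cs - v sn` and `v cs + ω² u sn` are constant along solutions, equal to `u 0`
and `v 0`; solving for `u` uses the Wronskian identity. -/
lemma eq_initial_data_combination {u v : ℝ → ℂ} (hω : ω ≠ 0)
    (hu : ∀ x ∈ Icc (0 : ℝ) 1, HasDerivAt u (v x) x)
    (hv : ∀ x ∈ Icc (0 : ℝ) 1, HasDerivAt v (-ω ^ 2 * u x) x) :
    ∀ x ∈ Icc (0 : ℝ) 1, u x = u 0 * cs ω x + v 0 * sn ω x := by
  have hw1 : ∀ x ∈ Icc (0 : ℝ) 1, HasDerivAt (fun x => u x * cs ω x - v x * sn ω x) 0 x := by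
    intro x hx
    refine (((hu x hx).mul (hasDerivAt_cs hω x)).sub
      ((hv x hx).mul (hasDerivAt_sn hω x))).congr_deriv ?_
    ring
  have hw2 : ∀ x ∈ Icc (0 : ℝ) 1,
      HasDerivAt (fun x => v x * cs ω x + ω ^ 2 * (u x * sn ω x)) 0 x := by
    intro x hx
    refine (((hv x hx).mul (hasDerivAt_cs hω x)).add
      (((hu x hx).mul (hasDerivAt_sn hω x)).const_mul (ω ^ 2))).congr_deriv ?_
    ring
  intro x hx
  have c1 := constant_of_has_deriv_right_zero
    (fun t ht => (hw1 t ht).continuousAt.continuousWithinAt)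
    (fun t ht => (hw1 t (Ico_subset_Icc_self ht)).hasDerivWithinAt) x hx
  have c2 := constant_of_has_deriv_right_zero
    (fun t ht => (hw2 t ht).continuousAt.continuousWithinAt)
    (fun t ht => (hw2 t (Ico_subset_Icc_self ht)).hasDerivWithinAt) x hx
  simp only [sn_zero, cs_zero, mul_one, mul_zero, sub_zero, add_zero] at c1 c2
  rw [← c1, ← c2]
  linear_combination -u x * cs_sq_add hω x

/-- Uniqueness for the homogeneous equation on an edge. -/
lemma eq_combination_of_homogeneous (hω : ω ≠ 0) {f g : L2I} (hf : HasWeakDeriv f g)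
    (hg : HasWeakDeriv g ((-ω ^ 2) • f)) : ∃ γ a : ℂ, f = γ • csL ω + a • snL ω := by
  -- Bootstrap: `f` has a continuous representative, so `g` has a differentiable one, and then so
  -- does `f`; the classical uniqueness argument applies.
  obtain ⟨b, hb⟩ := hf.exists_primitive
  have hc : ContinuousOn (fun x => b + ∫ t in (0 : ℝ)..x, g t) (Icc 0 1) :=
    continuousOn_const.add (continuousOn_primitive_coeFn g)
  obtain ⟨v, hv, hgv⟩ := hg.exists_hasDerivAt (continuousOn_const.mul hc) (v := fun x =>
    -ω ^ 2 * (b + ∫ t in (0 : ℝ)..x, g t)) (by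
      filter_upwards [hb, Lp.coeFn_smul (-ω ^ 2) f] with x h1 h2
      rw [h2, Pi.smul_apply, h1, smul_eq_mul])
  have hvc : ContinuousOn v (Icc 0 1) := fun x hx => (hv x hx).continuousAt.continuousWithinAt
  obtain ⟨u, hu, hfu⟩ := hf.exists_hasDerivAt hvc hgv
  have huc : ContinuousOn u (Icc 0 1) := fun x hx => (hu x hx).continuousAt.continuousWithinAt
  have he := eqOn_Icc_of_ae_eq hc huc (hb.symm.trans hfu)
  have key := eq_initial_data_combination hω hu fun x hx => by
    have := hv x hx
    have e := he hx
    simp only at e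
    rwa [e] at this
  refine ⟨u 0, v 0, Lp.ext ?_⟩
  filter_upwards [hfu, Lp.coeFn_add (u 0 • csL ω) (v 0 • snL ω), Lp.coeFn_smul (u 0) (csL ω),
    Lp.coeFn_smul (v 0) (snL ω), coeFn_ofContinuousOn (continuous_cs ω).continuousOn,
    coeFn_ofContinuousOn (continuous_sn ω).continuousOn,
    ae_restrict_mem measurableSet_Ioo] with x h1 h2 h3 h4 h5 h6 hx
  rw [h1, h2, Pi.add_apply, h3, h4, Pi.smul_apply, Pi.smul_apply, csL, h5, snL, h6,
    key x (Ioo_subset_Icc_self hx), smul_eq_mul, smul_eq_mul]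

lemma eq_combination (hω : ω ≠ 0) {f g y : L2I} (hf : HasWeakDeriv f g)
    (hg : HasWeakDeriv g ((-ω ^ 2) • f + y)) :
    ∃ γ a : ℂ, f = γ • csL ω + a • snL ω + volterraL ω y := by
  obtain ⟨γ, a, h⟩ := eq_combination_of_homogeneous hω
    (hf.add ((hasWeakDeriv_volterraL hω y).smul (-1)))
    (by
      have := hg.add ((hasWeakDeriv_volterraDerivL hω y).smul (-1))
      convert this using 1
      module)
  refine ⟨γ, a, ?_⟩
  rw [← h]
  module

lemma hasWeakDeriv_combination (hω : ω ≠ 0) (γ a : ℂ) (y : L2I) :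
    HasWeakDeriv (γ • csL ω + a • snL ω + volterraL ω y)
      (γ • (-ω ^ 2) • snL ω + a • csL ω + volterraDerivL ω y) :=
  (((hasWeakDeriv_csL hω).smul γ).add ((hasWeakDeriv_snL hω).smul a)).add
    (hasWeakDeriv_volterraL hω y)

lemma hasWeakDeriv_combination_deriv (hω : ω ≠ 0) (γ a : ℂ) (y : L2I) :
    HasWeakDeriv (γ • (-ω ^ 2) • snL ω + a • csL ω + volterraDerivL ω y)
      ((-ω ^ 2) • (γ • csL ω + a • snL ω + volterraL ω y) + y) := by
  have := ((((hasWeakDeriv_snL hω).smul (-ω ^ 2)).smul γ).add ((hasWeakDeriv_csL hω).smul a)).add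
    (hasWeakDeriv_volterraDerivL hω y)
  convert this using 1
  module

lemma hasValueAt_combination (γ a : ℂ) (y : L2I) (x : ℝ) :
    HasValueAt (γ • csL ω + a • snL ω + volterraL ω y) x
      (γ * cs ω x + a * sn ω x + volterra ω y x) :=
  (((hasValueAt_ofContinuousOn _ x).smul γ).add ((hasValueAt_ofContinuousOn _ x).smul a)).add
    (hasValueAt_ofContinuousOn (continuousOn_volterra ω y) x)

lemma hasValueAt_combination_deriv (γ a : ℂ) (y : L2I) :
    HasValueAt (γ • (-ω ^ 2) • snL ω + a • csL ω + volterraDerivL ω y) 0 a := by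
  have := ((((hasValueAt_ofContinuousOn (continuous_sn ω).continuousOn 0).smul (-ω ^ 2)).smul γ).add
    ((hasValueAt_ofContinuousOn (continuous_cs ω).continuousOn 0).smul a)).add
    (hasValueAt_ofContinuousOn (continuousOn_volterraDeriv ω y) 0)
  simp only [sn_zero, cs_zero, volterraDeriv_zero, mul_zero, mul_one, zero_add, add_zero] at this
  exact this

/-! ### The boundary value problem on an edge -/

/-- The outgoing derivative at `0` of the solution of `f'' = -ω² f + y` with `f 0 = γ`,
`f 1 = 0`. -/
def slope (ω γ : ℂ) (y : L2I) : ℂ := -(γ * cs ω 1 + volterra ω y 1) / sn ω 1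

/-- The solution of `f'' = -ω² f + y` with `f 0 = γ` and `f 1 = 0`. -/
def edgeSol (ω γ : ℂ) (y : L2I) : L2I := γ • csL ω + slope ω γ y • snL ω + volterraL ω y

/-- The coefficient of `cs ω` is the value at `0`; the condition at `1` then determines that of `sn
ω`, since `sn ω 1 ≠ 0`. -/
lemma edgeSol_unique (hω : ω ≠ 0) (hs : sn ω 1 ≠ 0) {f g y : L2I} {γ d : ℂ}
    (hf : HasWeakDeriv f g) (hg : HasWeakDeriv g ((-ω ^ 2) • f + y)) (h1 : HasValueAt f 1 0)
    (h0 : HasValueAt f 0 γ) (hd : HasValueAt g 0 d) :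
    f = edgeSol ω γ y ∧ d = slope ω γ y := by
  obtain ⟨γ', a, rfl⟩ := eq_combination hω hf hg
  obtain rfl := hf.unique (hasWeakDeriv_combination hω γ' a y)
  have e0 := h0.unique (left_mem_Icc.2 zero_le_one) (hasValueAt_combination γ' a y 0)
  have e1 := h1.unique (right_mem_Icc.2 zero_le_one) (hasValueAt_combination γ' a y 1)
  have ed := hd.unique (left_mem_Icc.2 zero_le_one) (hasValueAt_combination_deriv γ' a y)
  simp only [cs_zero, mul_one, sn_zero, mul_zero, add_zero, volterra_zero] at e0
  subst e0 ed
  have : d = slope ω γ y := by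
    rw [slope, eq_div_iff hs]
    linear_combination -e1
  rw [edgeSol, ← this]
  exact ⟨rfl, rfl⟩

lemma edgeSol_spec (hω : ω ≠ 0) (hs : sn ω 1 ≠ 0) (γ : ℂ) (y : L2I) :
    ∃ g, HasWeakDeriv (edgeSol ω γ y) g ∧ HasWeakDeriv g ((-ω ^ 2) • edgeSol ω γ y + y) ∧
      HasValueAt (edgeSol ω γ y) 1 0 ∧ HasValueAt (edgeSol ω γ y) 0 γ ∧
      HasValueAt g 0 (slope ω γ y) := by
  refine ⟨_, hasWeakDeriv_combination hω γ _ y, hasWeakDeriv_combination_deriv hω γ _ y, ?_, ?_,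
    hasValueAt_combination_deriv γ _ y⟩
  · have := hasValueAt_combination (ω := ω) γ (slope ω γ y) y 1
    have e : γ * cs ω 1 + slope ω γ y * sn ω 1 + volterra ω y 1 = 0 := by
      rw [slope, div_mul_cancel₀ _ hs]; ring
    rwa [e] at this
  · simpa [edgeSol] using hasValueAt_combination (ω := ω) γ (slope ω γ y) y 0

end

/-! ### The operator on the graph -/

/-- The frequency on the edge `j` at the spectral parameter `k ^ 2`. -/
def freq (nP : ℕ) (k : ℝ) {n : ℕ} (j : Fin n) : ℂ := if j.val < nP then k else k * Complex.I

/-- The sign with which `d²/dx²` enters the operator on the edge `j`. -/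
def edgeSign (nP : ℕ) {n : ℕ} (j : Fin n) : ℂ := if j.val < nP then -1 else 1

section

variable {nP nM : ℕ} {k : ℝ}

lemma edgeSign_mul_self {n : ℕ} (j : Fin n) : edgeSign nP j * edgeSign nP j = 1 := by
  unfold edgeSign; split_ifs <;> norm_num

lemma neg_freq_sq {n : ℕ} (j : Fin n) : -freq nP k j ^ 2 = edgeSign nP j * (k : ℂ) ^ 2 := by
  unfold freq edgeSign
  split_ifs
  · ring
  · rw [mul_pow, Complex.I_sq]; ring

lemma freq_ne_zero (hk : 0 < k) {n : ℕ} (j : Fin n) : freq nP k j ≠ 0 := by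
  have : (k : ℂ) ≠ 0 := Complex.ofReal_ne_zero.2 hk.ne'
  unfold freq
  split_ifs
  · exact this
  · exact mul_ne_zero this Complex.I_ne_zero

lemma sn_ofReal_one (k : ℝ) : sn k 1 = ((Real.sin k / k : ℝ) : ℂ) := by simp [sn]

lemma cs_ofReal_one (k : ℝ) : cs k 1 = (Real.cos k : ℂ) := by simp [cs]

lemma sn_ofReal_mul_I_one (k : ℝ) : sn (k * Complex.I) 1 = ((Real.sinh k / k : ℝ) : ℂ) := by
  rw [sn, Complex.ofReal_one, mul_one, Complex.sin_mul_I, mul_div_mul_right _ _ Complex.I_ne_zero]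
  simp

lemma cs_ofReal_mul_I_one (k : ℝ) : cs (k * Complex.I) 1 = (Real.cosh k : ℂ) := by
  rw [cs, Complex.ofReal_one, mul_one, Complex.cos_mul_I, Complex.ofReal_cosh]

/-- The bound `k < π` keeps `k²` below `π²`, the first Dirichlet eigenvalue of a single edge. -/
lemma sn_freq_ne_zero (hk : 0 < k) (hk' : k < Real.pi) {n : ℕ} (j : Fin n) :
    sn (freq nP k j) 1 ≠ 0 := by
  unfold freq
  split_ifs
  · rw [sn_ofReal_one]
    exact Complex.ofReal_ne_zero.2 (div_ne_zero (Real.sin_pos_of_pos_of_lt_pi hk hk').ne' hk.ne')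
  · rw [sn_ofReal_mul_I_one]
    exact Complex.ofReal_ne_zero.2 (div_ne_zero (Real.sinh_pos_iff.2 hk).ne' hk.ne')

lemma kirchhoffB_apply (x : (kirchhoffB nP nM).domain) (j : Fin (nP + nM)) :
    (kirchhoffB nP nM x) j = edgeSign nP j • weakDeriv (weakDeriv ((x : L2G (nP + nM)) j)) := by
  change (if j.val < nP then - weakDeriv (weakDeriv (x.1 j)) else weakDeriv (weakDeriv (x.1 j))) = _
  unfold edgeSign
  split_ifs <;> simp

/-- Multiplying the `j`-th component by its sign, whose square is `1`, turns the equation into `f''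
= -ω² f + ε y`, and uniqueness on the edge applies. -/
lemma eq_edgeSol_of_mem_domain (hk : 0 < k) (hs : ∀ j : Fin (nP + nM), sn (freq nP k j) 1 ≠ 0)
    (x : (kirchhoffB nP nM).domain) (y : L2G (nP + nM))
    (h : kirchhoffB nP nM x - ((k : ℂ) ^ 2) • (x : L2G (nP + nM)) = y) :
    ∃ γ : ℂ, (∀ j, (x : L2G (nP + nM)) j = edgeSol (freq nP k j) γ (edgeSign nP j • y j)) ∧
      ∑ j, slope (freq nP k j) γ (edgeSign nP j • y j) = 0 := by
  obtain ⟨h2, h1, ⟨γ, h0⟩, d, hd, hsum⟩ := x.2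
  have key : ∀ j, (x : L2G (nP + nM)) j = edgeSol (freq nP k j) γ (edgeSign nP j • y j) ∧
      d j = slope (freq nP k j) γ (edgeSign nP j • y j) := by
    intro j
    refine edgeSol_unique (freq_ne_zero hk j) (hs j) (hasWeakDeriv_weakDeriv (h2 j).1) ?_ (h1 j)
      (h0 j) (hd j)
    have e := hasWeakDeriv_weakDeriv (h2 j).2
    convert e using 1
    rw [← h, PiLp.sub_apply, PiLp.smul_apply, kirchhoffB_apply, smul_sub, smul_smul, smul_smul,
      edgeSign_mul_self, neg_freq_sq, one_smul]
    abel
  refine ⟨γ, fun j => (key j).1, ?_⟩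
  rw [← hsum]
  exact Finset.sum_congr rfl fun j _ => (key j).2.symm

lemma edgeSol_mem_domain (hk : 0 < k) (hs : ∀ j : Fin (nP + nM), sn (freq nP k j) 1 ≠ 0)
    (x y : L2G (nP + nM)) {γ : ℂ}
    (hx : ∀ j, x j = edgeSol (freq nP k j) γ (edgeSign nP j • y j))
    (hγ : ∑ j, slope (freq nP k j) γ (edgeSign nP j • y j) = 0) :
    ∃ h : x ∈ (kirchhoffB nP nM).domain,
      kirchhoffB nP nM ⟨x, h⟩ - ((k : ℂ) ^ 2) • x = y := by
  have key := fun j => edgeSol_spec (freq_ne_zero hk j) (hs j) γ (edgeSign nP j • y j)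
  simp only [← hx] at key
  choose g k1 k2 k3 k4 k5 using key
  have w1 : ∀ j, weakDeriv (x j) = g j := fun j => (k1 j).weakDeriv_eq
  refine ⟨⟨fun j => ⟨⟨_, k1 j⟩, by rw [w1]; exact ⟨_, k2 j⟩⟩, k3, ⟨γ, k4⟩, _,
    fun j => by rw [w1]; exact k5 j, hγ⟩, ?_⟩
  ext1 j
  rw [PiLp.sub_apply, PiLp.smul_apply, kirchhoffB_apply]
  change edgeSign nP j • weakDeriv (weakDeriv (x j)) - _ = _
  rw [w1, (k2 j).weakDeriv_eq, neg_freq_sq, smul_add, smul_smul, smul_smul, ← mul_assoc,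
    edgeSign_mul_self, one_mul, one_smul, add_sub_cancel_left]

/-! ### The Kirchhoff condition as a scalar equation -/

/-- The characteristic function whose zeros `k` give the eigenvalues `k ^ 2`. -/
def charFun (nP nM : ℕ) (k : ℝ) : ℝ :=
  nP * (Real.cos k / Real.sin k) + nM * (Real.cosh k / Real.sinh k)

lemma sum_cs_div_sn (nP nM : ℕ) (k : ℝ) :
    ∑ j : Fin (nP + nM), cs (freq nP k j) 1 / sn (freq nP k j) 1 = ((k * charFun nP nM k : ℝ) : ℂ) := by
  have h1 : ∀ i : Fin nP, freq nP k (Fin.castAdd nM i) = k := fun i => by simp [freq]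
  have h2 : ∀ i : Fin nM, freq nP k (Fin.natAdd nP i) = k * Complex.I := fun i => by simp [freq]
  rw [Fin.sum_univ_add]
  simp only [h1, h2, sn_ofReal_one, cs_ofReal_one, sn_ofReal_mul_I_one, cs_ofReal_mul_I_one,
    Finset.sum_const, Finset.card_univ, Fintype.card_fin, nsmul_eq_mul, charFun]
  push_cast
  rw [div_div_eq_mul_div, div_div_eq_mul_div]
  ring

lemma slope_sum (γ : ℂ) (y : Fin (nP + nM) → L2I) :
    ∑ j, slope (freq nP k j) γ (y j) = -(γ * ((k * charFun nP nM k : ℝ) : ℂ) +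
      ∑ j, volterraEnd (freq nP k j) (y j) / sn (freq nP k j) 1) := by
  rw [← sum_cs_div_sn, Finset.mul_sum, ← Finset.sum_add_distrib, ← Finset.sum_neg_distrib]
  refine Finset.sum_congr rfl fun j _ => ?_
  rw [slope, volterraEnd_apply]
  ring

lemma edgeSol_zero_zero (ω : ℂ) : edgeSol ω 0 0 = 0 := by
  simp [edgeSol, slope, ← volterraEnd_apply]

/-- With `y = 0` the Kirchhoff condition is `γ k D(k) = 0`, and `γ = 0` would make every component
vanish. -/
lemma charFun_eq_zero_of_mem_pointSpectrum (hk : 0 < k) (hk' : k < Real.pi)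
    (h : (k : ℂ) ^ 2 ∈ pointSpectrum (kirchhoffB nP nM)) : charFun nP nM k = 0 := by
  obtain ⟨x, hx0, hx⟩ := h
  obtain ⟨γ, h1, h2⟩ := eq_edgeSol_of_mem_domain hk (sn_freq_ne_zero hk hk') x 0
    (by rw [hx, sub_self])
  rw [slope_sum] at h2
  simp only [PiLp.zero_apply, smul_zero, map_zero, zero_div, Finset.sum_const_zero, add_zero,
    neg_eq_zero, mul_eq_zero, Complex.ofReal_eq_zero, hk.ne', false_or] at h1 h2
  refine h2.resolve_left fun hγ => hx0 ?_
  ext1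
  ext1 j
  rw [h1, hγ, edgeSol_zero_zero]
  rfl

/-- Vertex value `1` on every edge satisfies the Kirchhoff condition and makes the eigenfunction
nonzero. -/
lemma mem_pointSpectrum_of_charFun_eq_zero (hn : 0 < nP + nM) (hk : 0 < k) (hk' : k < Real.pi)
    (h : charFun nP nM k = 0) : (k : ℂ) ^ 2 ∈ pointSpectrum (kirchhoffB nP nM) := by
  let x : L2G (nP + nM) := WithLp.toLp 2 fun j => edgeSol (freq nP k j) 1 0
  obtain ⟨hx, hB⟩ := edgeSol_mem_domain hk (sn_freq_ne_zero hk hk') x 0 (γ := 1)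
    (fun j => by simp [x]) (by rw [slope_sum]; simp [h])
  refine ⟨⟨x, hx⟩, fun h0 => ?_, sub_eq_zero.1 hB⟩
  have hxj : x ⟨0, hn⟩ = 0 := by
    have : x = 0 := congrArg Subtype.val h0
    rw [this]; rfl
  obtain ⟨g, -, -, -, h4, -⟩ := edgeSol_spec (freq_ne_zero hk (⟨0, hn⟩ : Fin (nP + nM)))
    (sn_freq_ne_zero (nP := nP) hk hk' _) 1 0
  change HasValueAt (x ⟨0, hn⟩) 0 1 at h4
  rw [hxj] at h4
  exact one_ne_zero (h4.unique (left_mem_Icc.2 zero_le_one) (HasValueAt.zero 0))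

/-! ### The resolvent -/

/-- The value at the central vertex of the solution of `B f - k² f = y`. -/
def vertexValue (nP nM : ℕ) (k : ℝ) : L2G (nP + nM) →L[ℂ] ℂ :=
  (-(((k * charFun nP nM k : ℝ) : ℂ)⁻¹)) • ∑ j, (sn (freq nP k j) 1)⁻¹ •
    (volterraEnd (freq nP k j)).comp (edgeSign nP j • PiLp.proj 2 (fun _ : Fin (nP + nM) => L2I) j)

lemma vertexValue_mul (hD : ((k * charFun nP nM k : ℝ) : ℂ) ≠ 0) (y : L2G (nP + nM)) :
    vertexValue nP nM k y * ((k * charFun nP nM k : ℝ) : ℂ) =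
      -∑ j, volterraEnd (freq nP k j) (edgeSign nP j • y j) / sn (freq nP k j) 1 := by
  have e : vertexValue nP nM k y = -(((k * charFun nP nM k : ℝ) : ℂ)⁻¹) *
      ∑ j, volterraEnd (freq nP k j) (edgeSign nP j • y j) / sn (freq nP k j) 1 := by
    simp only [vertexValue, smul_apply, sum_apply, ContinuousLinearMap.comp_apply,
      PiLp.proj_apply, smul_eq_mul]
    congr 1
    exact Finset.sum_congr rfl fun j _ => by rw [div_eq_inv_mul]
  rw [e, neg_mul, neg_mul, mul_right_comm, inv_mul_cancel₀ hD, one_mul]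

/-- The solution operator of `f'' = -ω² f + y`, `f 0 = γ`, `f 1 = 0`, with `γ` and `y` depending
linearly on a parameter. -/
def edgeSolL {H : Type*} [NormedAddCommGroup H] [NormedSpace ℂ H] (ω : ℂ) (γ : H →L[ℂ] ℂ)
    (y : H →L[ℂ] L2I) : H →L[ℂ] L2I :=
  γ.smulRight (csL ω) +
    (-(sn ω 1)⁻¹ • (cs ω 1 • γ + (volterraEnd ω).comp y)).smulRight (snL ω) + (volterraL ω).comp y

lemma edgeSolL_apply {H : Type*} [NormedAddCommGroup H] [NormedSpace ℂ H] (ω : ℂ) (γ : H →L[ℂ] ℂ)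
    (y : H →L[ℂ] L2I) (x : H) : edgeSolL ω γ y x = edgeSol ω (γ x) (y x) := by
  have : slope ω (γ x) (y x) = -(sn ω 1)⁻¹ * (cs ω 1 * γ x + volterraEnd ω (y x)) := by
    rw [slope, volterraEnd_apply]; ring
  rw [edgeSol, this]
  rfl

/-- The resolvent of the indefinite Kirchhoff Laplacian at `k ^ 2`. -/
def resolventL (nP nM : ℕ) (k : ℝ) : L2G (nP + nM) →L[ℂ] L2G (nP + nM) :=
  ((PiLp.continuousLinearEquiv 2 ℂ (fun _ : Fin (nP + nM) => L2I)).symm :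
      (Fin (nP + nM) → L2I) →L[ℂ] L2G (nP + nM)).comp
    (ContinuousLinearMap.pi fun j => edgeSolL (freq nP k j) (vertexValue nP nM k)
      (edgeSign nP j • PiLp.proj 2 (fun _ : Fin (nP + nM) => L2I) j))

lemma resolventL_apply (y : L2G (nP + nM)) (j : Fin (nP + nM)) :
    resolventL nP nM k y j =
      edgeSol (freq nP k j) (vertexValue nP nM k y) (edgeSign nP j • y j) := by
  have e : (edgeSign nP j • PiLp.proj (𝕜 := ℂ) 2 (fun _ : Fin (nP + nM) => L2I) j) y =
      edgeSign nP j • y j := by rw [smul_apply, PiLp.proj_apply]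
  rw [← e, ← edgeSolL_apply]
  rfl

/-- Since `k D(k) ≠ 0`, the Kirchhoff condition has exactly one solution `γ`, which depends
boundedly on `y`. -/
lemma mem_opResolventSet_of_charFun_ne_zero (hk : 0 < k) (hk' : k < Real.pi)
    (h : charFun nP nM k ≠ 0) : (k : ℂ) ^ 2 ∈ opResolventSet (kirchhoffB nP nM) := by
  have hD : ((k * charFun nP nM k : ℝ) : ℂ) ≠ 0 := Complex.ofReal_ne_zero.2 (mul_ne_zero hk.ne' h)
  refine ⟨resolventL nP nM k, fun y => ?_, fun x => ?_⟩
  · refine edgeSol_mem_domain hk (sn_freq_ne_zero hk hk') _ y (resolventL_apply y) ?_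
    rw [slope_sum, vertexValue_mul hD, neg_add_cancel, neg_zero]
  · set y := kirchhoffB nP nM x - ((k : ℂ) ^ 2) • (x : L2G (nP + nM)) with hy
    obtain ⟨γ, h1, h2⟩ := eq_edgeSol_of_mem_domain hk (sn_freq_ne_zero hk hk') x y hy.symm
    clear_value y
    rw [slope_sum, neg_eq_zero] at h2
    have hγ : vertexValue nP nM k y = γ :=
      mul_right_cancel₀ hD ((vertexValue_mul hD y).trans (eq_neg_of_add_eq_zero_left h2).symm)
    ext1 j
    rw [resolventL_apply, h1 j, hγ]

end

lemma pointSpectrum_subset_opSpectrum {H : Type*} [NormedAddCommGroup H] [NormedSpace ℂ H]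
    (T : H →ₗ.[ℂ] H) : pointSpectrum T ⊆ opSpectrum T := by
  rintro z ⟨x, hx, hTx⟩ ⟨R, -, hR⟩
  have := hR x
  rw [hTx, sub_self, map_zero] at this
  exact hx (Subtype.ext this.symm)

/-! ### The smallest positive eigenvalue -/

section

variable {nP nM : ℕ}


/-- The characteristic function is strictly decreasing on `(0, π)`. -/
lemma charFun_strictAnti (hP : 1 ≤ nP) {k l : ℝ} (hk : 0 < k) (hkl : k < l) (hl : l < Real.pi) :
    charFun nP nM l < charFun nP nM k := by
  have a1 : 0 < Real.sin k := Real.sin_pos_of_pos_of_lt_pi hk (hkl.trans hl)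
  have a2 : 0 < Real.sin l := Real.sin_pos_of_pos_of_lt_pi (hk.trans hkl) hl
  have b1 : 0 < Real.sinh k := Real.sinh_pos_iff.2 hk
  have b2 : 0 < Real.sinh l := Real.sinh_pos_iff.2 (hk.trans hkl)
  -- Cross-multiplied, this is `sin (l - k) > 0`; the hyperbolic analogue below is `sinh (l - k) >
  -- 0`.
  have c1 : Real.cos l / Real.sin l < Real.cos k / Real.sin k := by
    rw [div_lt_div_iff₀ a2 a1]
    have := Real.sin_pos_of_pos_of_lt_pi (sub_pos.2 hkl) (by linarith)
    rw [Real.sin_sub] at this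
    linarith
  have c2 : Real.cosh l / Real.sinh l ≤ Real.cosh k / Real.sinh k := by
    rw [div_le_div_iff₀ b2 b1]
    have := Real.sinh_pos_iff.2 (sub_pos.2 hkl)
    rw [Real.sinh_sub] at this
    linarith
  have hP' : (0 : ℝ) < nP := by exact_mod_cast hP
  exact add_lt_add_of_lt_of_le (mul_lt_mul_of_pos_left c1 hP')
    (mul_le_mul_of_nonneg_left c2 (Nat.cast_nonneg _))

lemma exists_charFun_eq_zero (hP : 1 ≤ nP) (hM : 1 ≤ nM) :
    ∃ k : ℝ, 0 < k ∧ k < Real.pi ∧ charFun nP nM k = 0 := by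
  -- `F` is `charFun` times `sin k · sinh k`: clearing denominators allows evaluation at `π`, where
  -- `cot` is singular.
  let F : ℝ → ℝ := fun k =>
    nP * (Real.cos k * Real.sinh k) + nM * (Real.cosh k * Real.sin k)
  have hF : ContinuousOn F (Icc (Real.pi / 2) Real.pi) := by
    refine Continuous.continuousOn ?_
    have := Real.continuous_sinh
    have := Real.continuous_cosh
    fun_prop
  have hpi := Real.pi_pos
  have hP' : (0 : ℝ) < nP := by exact_mod_cast hP
  have hM' : (0 : ℝ) < nM := by exact_mod_cast hM
  have h1 : F Real.pi < 0 := by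
    simp only [F, Real.cos_pi, Real.sin_pi, mul_zero, add_zero, neg_one_mul, mul_neg, neg_lt_zero]
    exact mul_pos hP' (Real.sinh_pos_iff.2 hpi)
  have h2 : 0 < F (Real.pi / 2) := by
    simp only [F, Real.cos_pi_div_two, Real.sin_pi_div_two, zero_mul, mul_zero, zero_add, mul_one]
    exact mul_pos hM' (Real.cosh_pos _)
  obtain ⟨k, ⟨hk1, hk2⟩, hk⟩ := intermediate_value_Ioo' (by linarith) hF ⟨h1, h2⟩
  have hk0 : 0 < k := by linarith
  have a1 : 0 < Real.sin k := Real.sin_pos_of_pos_of_lt_pi hk0 hk2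
  have b1 : 0 < Real.sinh k := Real.sinh_pos_iff.2 hk0
  refine ⟨k, hk0, hk2, ?_⟩
  have e : charFun nP nM k = F k / (Real.sin k * Real.sinh k) := by
    simp only [charFun, F]
    field_simp
  rw [e, hk, zero_div]

lemma ratio_eq_of_charFun_eq_zero (hM : 1 ≤ nM) {k : ℝ} (hk : 0 < k)
    (hk' : k < Real.pi) (h : charFun nP nM k = 0) :
    (nP : ℝ) / nM = - coth k * Real.tan k := by
  have a1 : 0 < Real.sin k := Real.sin_pos_of_pos_of_lt_pi hk hk'
  have b1 : 0 < Real.sinh k := Real.sinh_pos_iff.2 hk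
  have hM' : (0 : ℝ) < nM := by exact_mod_cast hM
  -- If `cos k` vanished, only the positive term `nM coth k` would remain.
  have hc : Real.cos k ≠ 0 := by
    intro hc
    rw [charFun, hc, zero_div, mul_zero, zero_add] at h
    exact (mul_pos hM' (div_pos (Real.cosh_pos k) b1)).ne' h
  rw [charFun] at h
  rw [coth, Real.tan_eq_sin_div_cos]
  field_simp at h ⊢
  linarith

lemma isLeast_sq_of_charFun_eq_zero (hP : 1 ≤ nP) {k : ℝ} (hk : 0 < k)
    (hk' : k < Real.pi) (h : charFun nP nM k = 0) :
    IsLeast {t : ℝ | 0 < t ∧ (t : ℂ) ∈ pointSpectrum (kirchhoffB nP nM)} (k ^ 2) := by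
  refine ⟨⟨by positivity, ?_⟩, fun t ⟨ht, hmem⟩ => ?_⟩
  · rw [Complex.ofReal_pow]
    exact mem_pointSpectrum_of_charFun_eq_zero (by omega) hk hk' h
  · by_contra! hlt
    have hs : 0 < Real.sqrt t := Real.sqrt_pos.2 ht
    have hsk : Real.sqrt t < k := (Real.sqrt_lt' hk).2 hlt
    have h0 : charFun nP nM (Real.sqrt t) = 0 := by
      refine charFun_eq_zero_of_mem_pointSpectrum hs (hsk.trans hk') ?_
      rwa [← Complex.ofReal_pow, Real.sq_sqrt ht.le]
    -- A smaller positive eigenvalue would give a second zero of a strictly decreasing function.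
    exact (charFun_strictAnti hP hs hsk hk').ne (h.trans h0.symm)

end

end StarGraph

end

theorem mainTheorem4 (nP nM : ℕ) (hP : 1 ≤ nP) (hM : 1 ≤ nM) :
    (∃ η : ℝ,
      IsLeast {t : ℝ | 0 < t ∧ (t : ℂ) ∈ StarGraph.pointSpectrum (StarGraph.kirchhoffB nP nM)} η ∧
      (nP : ℝ) / (nM : ℝ) = - StarGraph.coth (Real.sqrt η) * Real.tan (Real.sqrt η)) ∧
    (∀ mP mM : ℕ, 1 ≤ mP → 1 ≤ mM →
      StarGraph.opSpectrum (StarGraph.kirchhoffB nP nM) =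
        StarGraph.opSpectrum (StarGraph.kirchhoffB mP mM) →
      (nP : ℝ) / (nM : ℝ) = (mP : ℝ) / (mM : ℝ)) := by
  obtain ⟨k, hk, hk', h⟩ := StarGraph.exists_charFun_eq_zero hP hM
  refine ⟨⟨k ^ 2, StarGraph.isLeast_sq_of_charFun_eq_zero hP hk hk' h, ?_⟩,
    fun mP mM hmP hmM hspec => ?_⟩
  · rw [Real.sqrt_sq hk.le]
    exact StarGraph.ratio_eq_of_charFun_eq_zero hM hk hk' h
  · have hmem : (k : ℂ) ^ 2 ∈ StarGraph.opSpectrum (StarGraph.kirchhoffB mP mM) := by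
      rw [← hspec]
      exact StarGraph.pointSpectrum_subset_opSpectrum _
        (StarGraph.mem_pointSpectrum_of_charFun_eq_zero (by omega) hk hk' h)
    -- The bound `k < π` comes from the first graph, yet it suffices to apply the resolvent
    -- construction to the second.
    have h' : StarGraph.charFun mP mM k = 0 := by
      by_contra hne
      exact hmem (StarGraph.mem_opResolventSet_of_charFun_ne_zero hk hk' hne)
    rw [StarGraph.ratio_eq_of_charFun_eq_zero hM hk hk' h,
      StarGraph.ratio_eq_of_charFun_eq_zero hmM hk hk' h']
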